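/- For $k\in\{0,1,-1\}$ let $\gamma_0^{(k)}$ be the two-dimensional Lorentzian metric of constant curvature $k$ on $\mathbb{R}^2$ with coordinates $(t,x)$ given by $$\gamma_0^{(0)}=-dt^2+dx^2,\qquad \gamma_0^{(1)}=-dt^2+\cosh^2 t\,dx^2,\qquad \gamma_0^{(-1)}=-\cosh^2 x\,dt^2+dx^2,$$ i.e. the Minkowski metric and the de Sitter and anti-de Sitter metrics (in global coordinates on the universal cover), which satisfy $\mathrm{Ric}=k\,\gamma_0^{(k)}$. Let $(S,\gamma_1)$ be a connected smooth two-dimensional Riemannian manifold without boundary, let $w:S\to\mathbb{R}$ be a smooth nowhere vanishing function, and consider on the four-manifold $S\times\mathbb{R}^2$ the metric $$g=\gamma_1+w^2\,\gamma_0^{(k)} .$$ Suppose that $g$ is Einstein with cosmological constant $\Lambda\in\mathbb{R}$, that is, $\mathrm{Ric}(g)=\Lambda g$. 1. If $w$ is not constant, then the set of points of $S$ where $dw\neq 0$ is dense (and open) in $S$, and there is a constant $c\in\mathbb{R}$ such that every point $(p,q)\in S\times\mathbb{R}^2$ with $dw_p\ne0$ has an open neighbourhood on which $g$ is isometric, by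 a smooth diffeomorphism onto an open subset of the region $\{r>0,\ k+\frac cr-\frac\Lambda3r^2>0\}$ of $\mathbb{R}^4$ with coordinates $(\tau,r,t,x)$, to the metric $$\Big(k+\frac cr-\frac{\Lambda}{3}r^2\Big)d\tau^2+\frac{dr^2}{k+\frac cr-\frac{\Lambda}{3}r^2}+r^2\gamma_0^{(k)} .$$ 2. If $w$ is equal to a constant $a$, then $\mathrm{Ric}(\gamma_1)=\Lambda\gamma_1$ and $\mathrm{Ric}(a^2\gamma_0^{(k)})=\Lambda\, a^2\gamma_0^{(k)}$, and $\Lambda=k/a^2$. -/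

import Mathlib

set_option maxSynthPendingDepth 3

open scoped Manifold ContDiff

noncomputable section

namespace WarpedEinstein

/-! ### Curvature of a metric on an open piece of a normed space

`G : E → E →L[ℝ] E →L[ℝ] ℝ` is a field of symmetric bilinear forms on the finite-dimensional
space `E`. All formulas are local and are meant on open sets on which `G` is smooth and
nondegenerate (of any signature). -/

section Local

variable {E : Type*} [NormedAddCommGroup E] [NormedSpace ℝ E]

/-- Christoffel symbols of the first kind,
`christoffelLower G x u v z = ½ (∂_u G(v, z) + ∂_v G(u, z) - ∂_z G(u, v))`. -/
def christoffelLower (G : E → E →L[ℝ] E →L[ℝ] ℝ) (x : E) : E →L[ℝ] E →L[ℝ] E →L[ℝ] ℝ :=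
  let D : E →L[ℝ] E →L[ℝ] E →L[ℝ] ℝ := fderiv ℝ G x
  let D₂ : E →L[ℝ] E →L[ℝ] E →L[ℝ] ℝ := ContinuousLinearMap.flip D
  let flip' : (E →L[ℝ] E →L[ℝ] ℝ) →L[ℝ] E →L[ℝ] E →L[ℝ] ℝ :=
    (ContinuousLinearMap.flipₗᵢ ℝ E E ℝ).toContinuousLinearEquiv
  let D₃ : E →L[ℝ] E →L[ℝ] E →L[ℝ] ℝ := flip'.comp D₂
  (1 / 2 : ℝ) • (D + D₂ - D₃)

theorem christoffelLower_apply (G : E → E →L[ℝ] E →L[ℝ] ℝ) (x u v z : E) :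
    christoffelLower G x u v z =
      1 / 2 * (fderiv ℝ G x u v z + fderiv ℝ G x v u z - fderiv ℝ G x z u v) := by
  simp [christoffelLower]

/-- Christoffel symbols of the Levi-Civita connection: `christoffel G x u v` is the vector
`Γ_x(u, v)` with `G_x(Γ_x(u, v), z) = christoffelLower G x u v z` for all `z`; the index is raised
with the inverse of `G x`, seen as a map from `E` to its dual. -/
def christoffel (G : E → E →L[ℝ] E →L[ℝ] ℝ) (x : E) : E →L[ℝ] E →L[ℝ] E :=
  (ContinuousLinearMap.compL ℝ E (E →L[ℝ] ℝ) E (ContinuousLinearMap.inverse (G x))).comp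
    (christoffelLower G x)

theorem christoffel_apply (G : E → E →L[ℝ] E →L[ℝ] ℝ) (x u v : E) :
    christoffel G x u v = ContinuousLinearMap.inverse (G x) (christoffelLower G x u v) := by
  simp [christoffel]

/-- The curvature endomorphism `z ↦ R(z, u) v`, with
`R(z, u) v = ∂_z Γ(u, v) - ∂_u Γ(z, v) + Γ(z, Γ(u, v)) - Γ(u, Γ(z, v))`. -/
def curvatureMap (G : E → E →L[ℝ] E →L[ℝ] ℝ) (x u v : E) : E →ₗ[ℝ] E where
  toFun z :=
    fderiv ℝ (christoffel G) x z u v - fderiv ℝ (christoffel G) x u z v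
      + christoffel G x z (christoffel G x u v) - christoffel G x u (christoffel G x z v)
  map_add' y z := by
    simp only [map_add, add_apply]
    abel
  map_smul' a z := by
    simp only [map_smul, smul_apply, RingHom.id_apply, smul_sub, smul_add]

/-- Ricci curvature `Ric_x(u, v) = tr (z ↦ R(z, u) v)`. -/
def ricci (G : E → E →L[ℝ] E →L[ℝ] ℝ) (x u v : E) : ℝ :=
  LinearMap.trace ℝ E (curvatureMap G x u v)

end Local

/-! ### Metrics on manifolds without boundary -/

section Manifold

variable {E : Type*} [NormedAddCommGroup E] [NormedSpace ℝ E]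
  {H : Type*} [TopologicalSpace H] (I : ModelWithCorners ℝ E H)
  {M : Type*} [TopologicalSpace M] [ChartedSpace H M]
  {E' : Type*} [NormedAddCommGroup E'] [NormedSpace ℝ E']
  {H' : Type*} [TopologicalSpace H'] (J : ModelWithCorners ℝ E' H')
  {N : Type*} [TopologicalSpace N] [ChartedSpace H' N]

variable (M) in
/-- A field of bilinear forms on the tangent spaces of `M`. -/
abbrev BilinField :=
  (p : M) → TangentSpace I p →L[ℝ] TangentSpace I p →L[ℝ] ℝ

/-- The bilinear form `(u, v) ↦ B (A u, A v)`. -/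
def pullForm (A : E →L[ℝ] E') (B : E' →L[ℝ] E' →L[ℝ] ℝ) : E →L[ℝ] E →L[ℝ] ℝ :=
  B.bilinearComp A A

/-- The pullback `(f^* G)_p (u, v) = G_{f p} (df_p u, df_p v)` of a field of bilinear forms. -/
def pullback (f : M → N) (G : BilinField J N) : BilinField I M := fun p =>
  pullForm (E := E) (E' := E') (mfderiv I J f p) (G (f p))

/-- The coordinate expression of `G` in the preferred chart at `p`. -/
def inChart (G : BilinField I M) (p : M) : E → E →L[ℝ] E →L[ℝ] ℝ :=
  pullback 𝓘(ℝ, E) I (extChartAt I p).symm G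

/-- `Ric(G) = Λ G`, the equation being read in every chart `extChartAt I p`, on the whole image of
that chart. -/
def IsEinstein (G : BilinField I M) (Λ : ℝ) : Prop :=
  ∀ p : M, ∀ x ∈ (extChartAt I p).target, ∀ u v : E,
    ricci (inChart I G p) x u v = Λ * inChart I G p x u v

/-- The warped product `γ + w² γ'` on `M × N`, where `w` is a function on `M`. -/
def warpedProduct (γ : BilinField I M) (w : M → ℝ) (γ' : BilinField J N) :
    BilinField (I.prod J) (M × N) := fun m =>
  pullback (I.prod J) I Prod.fst γ m + (w m.1) ^ 2 • pullback (I.prod J) J Prod.snd γ' m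

/-- Some diffeomorphism `Φ` of an open neighbourhood of `m` in `M` onto an open subset of `N` that
lies in `D` satisfies `Φ^* G' = G`. -/
def LocallyIsometricAt (G : BilinField I M) (G' : BilinField J N) (D : Set N) (m : M) : Prop :=
  ∃ Φ : PartialDiffeomorph I J M N ∞, m ∈ Φ.source ∧ Φ.target ⊆ D ∧
    ∀ x ∈ Φ.source, pullback I J Φ G' x = G x

end Manifold

/-! ### The model metrics -/

/-- The bilinear form `a dx₁² + b dx₂²` on `ℝ²`. -/
def diagForm (a b : ℝ) : ℝ × ℝ →L[ℝ] ℝ × ℝ →L[ℝ] ℝ :=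
  a • (ContinuousLinearMap.fst ℝ ℝ ℝ).smulRight (ContinuousLinearMap.fst ℝ ℝ ℝ) +
    b • (ContinuousLinearMap.snd ℝ ℝ ℝ).smulRight (ContinuousLinearMap.snd ℝ ℝ ℝ)

theorem diagForm_apply (a b : ℝ) (u v : ℝ × ℝ) :
    diagForm a b u v = a * (u.1 * v.1) + b * (u.2 * v.2) := by
  simp [diagForm]

/-- The three Lorentzian model surfaces. -/
inductive ModelSurface
  | minkowski
  | deSitter
  | antiDeSitter

/-- The curvature `k`, which is `0`, `1`, `-1` respectively. -/
def ModelSurface.curvature : ModelSurface → ℝ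
  | .minkowski => 0
  | .deSitter => 1
  | .antiDeSitter => -1

/-- The metrics `γ₀^{(k)}`, in global coordinates `(t, x) ∈ ℝ²`: the Minkowski metric
`-dt² + dx²`, the de Sitter metric `-dt² + cosh² t dx²` and the anti-de Sitter metric
`-cosh² x dt² + dx²`. (In the last two cases `ℝ²` is the universal cover of the hyperboloid
`-X₀² + X₁² + X₂² = 1`, respectively `-X₀² - X₁² + X₂² = -1`.) -/
def ModelSurface.metric : ModelSurface → BilinField 𝓘(ℝ, ℝ × ℝ) (ℝ × ℝ)
  | .minkowski => fun _ => diagForm (-1) 1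
  | .deSitter => fun q => diagForm (-1) (Real.cosh q.1 ^ 2)
  | .antiDeSitter => fun q => diagForm (-Real.cosh q.2 ^ 2) 1

/-- The function `f(r) = k + c / r - Λ r² / 3`. -/
def kottlerFun (k c Λ r : ℝ) : ℝ := k + c / r - Λ / 3 * r ^ 2

/-- The metric `f(r) dτ² + dr² / f(r) + r² γ₀^{(k)}` in the coordinates `((τ, r), (t, x))`. -/
def kottler (k : ModelSurface) (c Λ : ℝ) :
    BilinField (𝓘(ℝ, ℝ × ℝ).prod 𝓘(ℝ, ℝ × ℝ)) ((ℝ × ℝ) × (ℝ × ℝ)) :=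
  warpedProduct 𝓘(ℝ, ℝ × ℝ) 𝓘(ℝ, ℝ × ℝ)
    (fun z : ℝ × ℝ =>
      diagForm (kottlerFun k.curvature c Λ z.2) (1 / kottlerFun k.curvature c Λ z.2))
    (fun z : ℝ × ℝ => z.2) k.metric

/-- The region `r > 0`, `f(r) > 0`, where the first two terms of `kottler` form a
Riemannian metric. -/
def kottlerDomain (k : ModelSurface) (c Λ : ℝ) : Set ((ℝ × ℝ) × (ℝ × ℝ)) :=
  {y | 0 < y.1.2 ∧ 0 < kottlerFun k.curvature c Λ y.1.2}

end WarpedEinstein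

end

/-!
# Einstein warped products over a surface

In a chart of `S`, write `W` for the warping function, `|dW|²` for the squared length of its
differential and `∇dW` for its Hessian. The Ricci tensor of `γ₁ + W² γ₀` is
`Ric(γ₁) - (2 / W) ∇dW` on the base (`ricci_warpedForm_base`) and
`Ric(γ₀) - (W ΔW + |dW|²) γ₀` on the fibre (`ricci_warpedForm_fibre`).

On a surface `Ric(γ₁)` is a multiple of the metric (`IsMetricOn.exists_ricci_eq`), so the base
equation says that `∇dW` is a multiple of `γ₁`; the fibre equation then gives
`∇dW = (k - |dW|² - Λ W²) / (2 W) γ₁` (`IsEinsteinOn.hessian_eq`). Since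
`d|dW|² = 2 ∇dW(grad W, ·)`, the quantity `c = W |dW|² - k W + Λ W³ / 3` is constant, that is
`|dW|² = f(W)` with `f(r) = k + c / r - Λ r² / 3`.

At a point where `dW = 0` and `k = Λ W²`, so that `∇dW = 0` too, the function `f` has a double zero;
then `|dW| ≤ C |W - W₀|` nearby, and `W` is constant there
(`IsEinsteinOn.eventually_eq_of_degenerate`). The set of such points is therefore open and closed,
and since it contains the interior of the critical set, `dW ≠ 0` on a dense set unless `W` is
constant (`dense_mfderiv_ne_zero`).

Where `dW ≠ 0`, the one-form `*dW / |dW|²` is closed because `∇dW` is a multiple of the metric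
(`IsMetricOn.fderiv_conjugateForm_symm`). If `τ` is a local primitive of it, then
`γ₁ = f(W) dτ² + dW² / f(W)`, so `(τ, W)` are the coordinates sought
(`IsEinsteinOn.exists_isometry`). For constant `W` the two displayed formulas for the Ricci
tensor give the second part at once.
-/

open scoped Manifold ContDiff

noncomputable section

namespace WarpedEinstein

/-! ### The Levi-Civita connection and its curvature -/

section LeviCivita

variable {E : Type*} [NormedAddCommGroup E] [NormedSpace ℝ E]

/-- `G` is a smooth pseudo-Riemannian metric on the open set `U`: symmetric, nondegenerate and of
class `C^∞`. -/
structure IsMetricOn (G : E → E →L[ℝ] E →L[ℝ] ℝ) (U : Set E) : Prop where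
  isOpen : IsOpen U
  contDiffOn : ContDiffOn ℝ ∞ G U
  symm : ∀ x ∈ U, ∀ u v, G x u v = G x v u
  nondeg : ∀ x ∈ U, ∀ u, (∀ v, G x u v = 0) → u = 0

theorem isInvertible_of_nondegenerate [FiniteDimensional ℝ E] {B : E →L[ℝ] E →L[ℝ] ℝ}
    (hB : ∀ u, (∀ v, B u v = 0) → u = 0) : B.IsInvertible := by
  have hinj : Function.Injective B := by
    refine (injective_iff_map_eq_zero B).2 fun u hu => hB u fun v => by simp [hu]
  have hdim : Module.finrank ℝ E = Module.finrank ℝ (E →L[ℝ] ℝ) := by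
    rw [← (LinearMap.toContinuousLinearMap (𝕜 := ℝ) (E := E) (F' := ℝ)).finrank_eq]
    exact (Subspace.dual_finrank_eq (K := ℝ) (V := E)).symm
  exact ⟨(LinearEquiv.ofInjectiveOfFinrankEq B.toLinearMap hinj hdim).toContinuousLinearEquiv, by
    ext u v; rfl⟩

theorem apply_inverse_of_nondegenerate [FiniteDimensional ℝ E] {B : E →L[ℝ] E →L[ℝ] ℝ}
    (hB : ∀ u, (∀ v, B u v = 0) → u = 0) (l : E →L[ℝ] ℝ) :
    B (ContinuousLinearMap.inverse B l) = l := by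
  obtain ⟨e, rfl⟩ := isInvertible_of_nondegenerate hB
  simp

theorem eq_of_nondegenerate {B : E →L[ℝ] E →L[ℝ] ℝ}
    (hB : ∀ u, (∀ v, B u v = 0) → u = 0) {u u' : E} (h : ∀ v, B u v = B u' v) : u = u' :=
  sub_eq_zero.1 (hB _ fun v => by simp [h v])

theorem fderiv_apply₂ {F : Type*} [NormedAddCommGroup F] [NormedSpace ℝ F]
    {B : E → E →L[ℝ] E →L[ℝ] F} {x : E} (hB : DifferentiableAt ℝ B x) (z u v : E) :
    fderiv ℝ (fun y => B y u v) x z = fderiv ℝ B x z u v := by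
  have h := ((hB.hasFDerivAt.clm_apply (hasFDerivAt_const u x)).clm_apply
    (hasFDerivAt_const v x)).fderiv
  rw [h]; simp

theorem fderiv_apply₂_apply {F : Type*} [NormedAddCommGroup F] [NormedSpace ℝ F]
    {B : E → E →L[ℝ] E →L[ℝ] F} {X Y : E → E} {x : E} (hB : DifferentiableAt ℝ B x)
    (hX : DifferentiableAt ℝ X x) (hY : DifferentiableAt ℝ Y x) (z : E) :
    fderiv ℝ (fun y => B y (X y) (Y y)) x z =
      fderiv ℝ B x z (X x) (Y x) + B x (fderiv ℝ X x z) (Y x) + B x (X x) (fderiv ℝ Y x z) := by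
  have h := ((hB.hasFDerivAt.clm_apply hX.hasFDerivAt).clm_apply hY.hasFDerivAt).fderiv
  rw [h]
  simp
  abel

namespace IsMetricOn

variable {G : E → E →L[ℝ] E →L[ℝ] ℝ} {U : Set E} (hG : IsMetricOn G U)
include hG

theorem contDiffAt {x : E} (hx : x ∈ U) : ContDiffAt ℝ ∞ G x :=
  hG.contDiffOn.contDiffAt (hG.isOpen.mem_nhds hx)

theorem differentiableAt {x : E} (hx : x ∈ U) : DifferentiableAt ℝ G x :=
  (hG.contDiffAt hx).differentiableAt (by simp)

theorem fderiv_symm {x : E} (hx : x ∈ U) (z u v : E) :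
    fderiv ℝ G x z u v = fderiv ℝ G x z v u := by
  rw [← fderiv_apply₂ (hG.differentiableAt hx), ← fderiv_apply₂ (hG.differentiableAt hx)]
  have h : (fun y => G y u v) =ᶠ[nhds x] fun y => G y v u := by
    filter_upwards [hG.isOpen.mem_nhds hx] with y hy using hG.symm y hy u v
  rw [h.fderiv_eq]

variable [FiniteDimensional ℝ E]

theorem apply_christoffel {x : E} (hx : x ∈ U) (u v z : E) :
    G x (christoffel G x u v) z = christoffelLower G x u v z := by
  rw [christoffel_apply, apply_inverse_of_nondegenerate (hG.nondeg x hx)]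

theorem christoffel_eq {x : E} (hx : x ∈ U) {u v X : E}
    (h : ∀ z, G x X z = christoffelLower G x u v z) : christoffel G x u v = X :=
  eq_of_nondegenerate (hG.nondeg x hx) fun z => by rw [hG.apply_christoffel hx, h]

theorem christoffel_symm {x : E} (hx : x ∈ U) (u v : E) :
    christoffel G x u v = christoffel G x v u :=
  hG.christoffel_eq hx fun z => by
    rw [hG.apply_christoffel hx, christoffelLower_apply, christoffelLower_apply,
      hG.fderiv_symm hx z u v]
    ring

/-- The connection is compatible with the metric. -/
theorem fderiv_apply {x : E} (hx : x ∈ U) (z u v : E) :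
    fderiv ℝ G x z u v = G x (christoffel G x z u) v + G x u (christoffel G x z v) := by
  rw [hG.symm x hx u, hG.apply_christoffel hx, hG.apply_christoffel hx, christoffelLower_apply,
    christoffelLower_apply, hG.fderiv_symm hx z v u, hG.fderiv_symm hx v z u]
  ring

theorem contDiffAt_inverse {x : E} (hx : x ∈ U) :
    ContDiffAt ℝ ∞ (fun y => ContinuousLinearMap.inverse (G y)) x :=
  ContDiffAt.comp x
    (isInvertible_of_nondegenerate (hG.nondeg x hx)).contDiffAt_map_inverse (hG.contDiffAt hx)

theorem contDiffAt_christoffel {x : E} (hx : x ∈ U) : ContDiffAt ℝ ∞ (christoffel G) x := by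
  have hD : ContDiffAt ℝ ∞ (fderiv ℝ G) x := (hG.contDiffAt hx).fderiv_right (by simp)
  have hL : ContDiffAt ℝ ∞ (christoffelLower G) x := by
    unfold christoffelLower
    have hflip : ContDiffAt ℝ ∞ (fun y => ContinuousLinearMap.flip (fderiv ℝ G y)) x :=
      ContDiffAt.comp x
        (ContinuousLinearMap.flipₗᵢ ℝ E E (E →L[ℝ] ℝ)).toContinuousLinearEquiv.contDiff.contDiffAt hD
    exact ((hD.add hflip).sub (contDiffAt_const.clm_comp hflip)).const_smul (1 / 2 : ℝ)
  exact ContDiffAt.clm_comp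
    ((ContinuousLinearMap.compL ℝ E (E →L[ℝ] ℝ) E).contDiff.contDiffAt.comp x
      (hG.contDiffAt_inverse hx)) hL

theorem differentiableAt_christoffel {x : E} (hx : x ∈ U) :
    DifferentiableAt ℝ (christoffel G) x :=
  (hG.contDiffAt_christoffel hx).differentiableAt (by simp)

theorem differentiableAt_christoffel_apply {x : E} (hx : x ∈ U) (u v : E) :
    DifferentiableAt ℝ (fun y => christoffel G y u v) x :=
  ((hG.differentiableAt_christoffel hx).clm_apply (differentiableAt_const u)).clm_apply
    (differentiableAt_const v)

/-- The curvature in terms of the derivatives of the vector fields `Γ(u, v)`. -/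
theorem curvatureMap_apply {x : E} (hx : x ∈ U) (u v z : E) :
    curvatureMap G x u v z =
      fderiv ℝ (fun y => christoffel G y u v) x z - fderiv ℝ (fun y => christoffel G y z v) x u
        + christoffel G x z (christoffel G x u v) - christoffel G x u (christoffel G x z v) := by
  rw [fderiv_apply₂ (hG.differentiableAt_christoffel hx),
    fderiv_apply₂ (hG.differentiableAt_christoffel hx)]
  rfl

/-- `G(R(z, u) v, t)` is skew in `v` and `t`: differentiate metric compatibility once more and use
that second derivatives of `G` commute. -/
theorem curvatureMap_skew {x : E} (hx : x ∈ U) (z u v t : E) :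
    G x (curvatureMap G x u v z) t = -G x (curvatureMap G x u t z) v := by
  have hdiff := hG.differentiableAt hx
  have key : ∀ a b, fderiv ℝ (fderiv ℝ G) x a b v t =
      G x (christoffel G x a (christoffel G x b v)) t
      + G x (christoffel G x b v) (christoffel G x a t)
      + G x (fderiv ℝ (fun y => christoffel G y b v) x a) t
      + (G x (christoffel G x a v) (christoffel G x b t)
      + G x v (christoffel G x a (christoffel G x b t))
      + G x v (fderiv ℝ (fun y => christoffel G y b t) x a)) := by
    intro a b
    have hD : DifferentiableAt ℝ (fderiv ℝ G) x :=
      ((hG.contDiffAt hx).fderiv_right (m := 1) (by norm_cast)).differentiableAt (by simp)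
    have h1 : fderiv ℝ (fun y => fderiv ℝ G y b v t) x a = fderiv ℝ (fderiv ℝ G) x a b v t := by
      have := fderiv_apply₂ (B := fun y => fderiv ℝ G y b)
        (hD.clm_apply (differentiableAt_const b)) a v t
      rw [this, (hD.hasFDerivAt.clm_apply (hasFDerivAt_const b x)).fderiv]
      simp
    have h2 : (fun y => fderiv ℝ G y b v t) =ᶠ[nhds x] fun y =>
        G y (christoffel G y b v) t + G y v (christoffel G y b t) := by
      filter_upwards [hG.isOpen.mem_nhds hx] with y hy using hG.fderiv_apply hy b v t
    have hv := hG.differentiableAt_christoffel_apply hx b v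
    have ht := hG.differentiableAt_christoffel_apply hx b t
    rw [← h1, h2.fderiv_eq, fderiv_fun_add
      ((hdiff.clm_apply hv).clm_apply (differentiableAt_const t))
      ((hdiff.clm_apply (differentiableAt_const v)).clm_apply ht), add_apply,
      fderiv_apply₂_apply hdiff hv (differentiableAt_const t),
      fderiv_apply₂_apply hdiff (differentiableAt_const v) ht]
    simp [hG.fderiv_apply hx]
  have hsymm : fderiv ℝ (fderiv ℝ G) x z u = fderiv ℝ (fderiv ℝ G) x u z :=
    ((hG.contDiffAt hx).isSymmSndFDerivAt (by simp; exact WithTop.coe_le_coe.2 le_top)).eq z u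
  have h := key z u
  rw [hsymm, key u z] at h
  rw [hG.symm x hx _ v, hG.curvatureMap_apply hx, hG.curvatureMap_apply hx]
  simp only [map_add, map_sub, add_apply, sub_apply]
  linarith

end IsMetricOn

theorem curvatureMap_swap (G : E → E →L[ℝ] E →L[ℝ] ℝ) (x u v z : E) :
    curvatureMap G x u v z = -curvatureMap G x z v u := by
  simp only [curvatureMap, LinearMap.coe_mk, AddHom.coe_mk]
  abel

end LeviCivita

/-! ### Gradient, Hessian and surfaces -/

section Hessian

variable {E : Type*} [NormedAddCommGroup E] [NormedSpace ℝ E]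

/-- The gradient of `W` with respect to `G`. -/
def metricGrad (G : E → E →L[ℝ] E →L[ℝ] ℝ) (W : E → ℝ) (x : E) : E :=
  ContinuousLinearMap.inverse (G x) (fderiv ℝ W x)

/-- The Hessian `∇dW` with respect to the Levi-Civita connection of `G`. -/
def hessian (G : E → E →L[ℝ] E →L[ℝ] ℝ) (W : E → ℝ) (x u v : E) : ℝ :=
  fderiv ℝ (fderiv ℝ W) x u v - fderiv ℝ W x (christoffel G x u v)

/-- The squared length `|dW|²` with respect to `G`. -/
def gradSq (G : E → E →L[ℝ] E →L[ℝ] ℝ) (W : E → ℝ) (x : E) : ℝ :=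
  fderiv ℝ W x (metricGrad G W x)

namespace IsMetricOn

variable [FiniteDimensional ℝ E] {G : E → E →L[ℝ] E →L[ℝ] ℝ} {U : Set E} (hG : IsMetricOn G U)
  {W : E → ℝ} {x : E}
include hG

theorem apply_metricGrad (hx : x ∈ U) (v : E) : G x (metricGrad G W x) v = fderiv ℝ W x v := by
  rw [metricGrad, apply_inverse_of_nondegenerate (hG.nondeg x hx)]

theorem contDiffAt_metricGrad (hx : x ∈ U) (hW : ContDiffAt ℝ ∞ W x) :
    ContDiffAt ℝ ∞ (metricGrad G W) x :=
  (hG.contDiffAt_inverse hx).clm_apply (hW.fderiv_right (by simp))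

theorem differentiableAt_metricGrad (hx : x ∈ U) (hW : ContDiffAt ℝ ∞ W x) :
    DifferentiableAt ℝ (metricGrad G W) x :=
  (hG.contDiffAt_metricGrad hx hW).differentiableAt (by simp)

/-- The covariant derivative of the gradient is the Hessian with one index raised. -/
theorem apply_covariantDeriv_metricGrad (hx : x ∈ U) (hW : ContDiffAt ℝ ∞ W x) (z t : E) :
    G x (fderiv ℝ (metricGrad G W) x z + christoffel G x z (metricGrad G W x)) t =
      hessian G W x z t := by
  have hX := hG.differentiableAt_metricGrad hx hW
  have hd : DifferentiableAt ℝ (fderiv ℝ W) x :=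
    (hW.fderiv_right (m := 1) (by norm_cast)).differentiableAt (by simp)
  have h : (fun y => G y (metricGrad G W y) t) =ᶠ[nhds x] fun y => fderiv ℝ W y t := by
    filter_upwards [hG.isOpen.mem_nhds hx] with y hy using hG.apply_metricGrad hy t
  have h' := DFunLike.congr_fun (F := E →L[ℝ] ℝ) h.fderiv_eq z
  rw [fderiv_apply₂_apply (hG.differentiableAt hx) hX (differentiableAt_const t),
    (hd.hasFDerivAt.clm_apply (hasFDerivAt_const t x)).fderiv, hG.fderiv_apply hx,
    hG.apply_metricGrad hx] at h'
  simp at h'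
  simp only [map_add, add_apply, hessian]
  linarith

variable {φ : ℝ}

theorem fderiv_metricGrad (hx : x ∈ U) (hW : ContDiffAt ℝ ∞ W x)
    (hφ : ∀ u v, hessian G W x u v = φ * G x u v) (z : E) :
    fderiv ℝ (metricGrad G W) x z = φ • z - christoffel G x z (metricGrad G W x) := by
  rw [eq_sub_iff_add_eq]
  refine eq_of_nondegenerate (hG.nondeg x hx) fun v => ?_
  rw [hG.apply_covariantDeriv_metricGrad hx hW, hφ]
  simp

theorem contDiffAt_gradSq (hx : x ∈ U) (hW : ContDiffAt ℝ ∞ W x) :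
    ContDiffAt ℝ ∞ (gradSq G W) x :=
  (hW.fderiv_right (by simp)).clm_apply (hG.contDiffAt_metricGrad hx hW)

theorem fderiv_gradSq (hx : x ∈ U) (hW : ContDiffAt ℝ ∞ W x)
    (hφ : ∀ u v, hessian G W x u v = φ * G x u v) (z : E) :
    fderiv ℝ (gradSq G W) x z = 2 * φ * fderiv ℝ W x z := by
  have hX := hG.differentiableAt_metricGrad hx hW
  have hd : DifferentiableAt ℝ (fderiv ℝ W) x :=
    (hW.fderiv_right (m := 1) (by norm_cast)).differentiableAt (by simp)
  have h := (hd.hasFDerivAt.clm_apply hX.hasFDerivAt).fderiv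
  have h' := hφ z (metricGrad G W x)
  rw [hG.symm x hx, hG.apply_metricGrad hx, hessian] at h'
  unfold gradSq
  rw [h]
  simp only [add_apply, ContinuousLinearMap.comp_apply, ContinuousLinearMap.flip_apply,
    hG.fderiv_metricGrad hx hW hφ, map_sub, map_smul, smul_eq_mul]
  linarith

end IsMetricOn

end Hessian

section Surface

variable {E : Type*} [NormedAddCommGroup E] [NormedSpace ℝ E] (b : Module.Basis (Fin 2) ℝ E)

theorem eq_coord_add (u : E) : u = b.coord 0 u • b 0 + b.coord 1 u • b 1 :=
  (b.sum_repr u).symm.trans (Fin.sum_univ_two _)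

theorem trace_eq_coord_add (f : E →ₗ[ℝ] E) :
    LinearMap.trace ℝ E f = b.coord 0 (f (b 0)) + b.coord 1 (f (b 1)) := by
  rw [LinearMap.trace_eq_matrix_trace ℝ b f]
  simp [Matrix.trace, Fin.sum_univ_two, LinearMap.toMatrix_apply]

theorem apply_eq_coord (B : E →L[ℝ] E →L[ℝ] ℝ) (u v : E) :
    B u v = b.coord 0 u * b.coord 0 v * B (b 0) (b 0) + b.coord 0 u * b.coord 1 v * B (b 0) (b 1)
      + b.coord 1 u * b.coord 0 v * B (b 1) (b 0) + b.coord 1 u * b.coord 1 v * B (b 1) (b 1) := by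
  conv_lhs => rw [eq_coord_add b u, eq_coord_add b v]
  simp only [map_add, map_smul, add_apply, smul_apply, smul_eq_mul]
  ring

/-- The Gram determinant of `B` in the basis `b`. -/
def gramDet (B : E →L[ℝ] E →L[ℝ] ℝ) : ℝ := B (b 0) (b 0) * B (b 1) (b 1) - B (b 0) (b 1) ^ 2

theorem gramDet_pos {B : E →L[ℝ] E →L[ℝ] ℝ} (hs : ∀ u v, B u v = B v u)
    (hB : ∀ u, u ≠ 0 → 0 < B u u) : 0 < gramDet b B := by
  have h1 := hB _ (b.ne_zero 1)
  have hX : B (b 1) (b 1) • b 0 - B (b 0) (b 1) • b 1 ≠ 0 := by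
    intro h
    have := congrArg (b.coord 0) h
    simp [h1.ne'] at this
  have h := hB _ hX
  simp only [map_sub, map_smul, sub_apply, smul_apply, smul_eq_mul, hs (b 1) (b 0)] at h
  refine pos_of_mul_pos_right (a := B (b 1) (b 1)) ?_ h1.le
  rw [gramDet]
  linarith

variable [FiniteDimensional ℝ E]

/-- The Euclidean area form of the basis `b`. -/
def areaForm : E →L[ℝ] E →L[ℝ] ℝ :=
  (LinearMap.toContinuousLinearMap (b.coord 0)).smulRight
      (LinearMap.toContinuousLinearMap (b.coord 1)) -
    (LinearMap.toContinuousLinearMap (b.coord 1)).smulRight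
      (LinearMap.toContinuousLinearMap (b.coord 0))

theorem areaForm_apply (u v : E) :
    areaForm b u v = b.coord 0 u * b.coord 1 v - b.coord 1 u * b.coord 0 v := by
  simp [areaForm]

/-- Lagrange's identity. -/
theorem gramDet_mul_areaForm_mul_areaForm {B : E →L[ℝ] E →L[ℝ] ℝ} (hs : ∀ u v, B u v = B v u)
    (X u v : E) :
    gramDet b B * (areaForm b X u * areaForm b X v) = B X X * B u v - B X u * B X v := by
  rw [apply_eq_coord b B X X, apply_eq_coord b B u v, apply_eq_coord b B X u,
    apply_eq_coord b B X v, areaForm_apply, areaForm_apply, gramDet, hs (b 1) (b 0)]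
  ring

theorem apply_mul_areaForm_sub (l : E →L[ℝ] ℝ) (X u v : E) :
    l v * areaForm b X u - l u * areaForm b X v = areaForm b v u * l X := by
  rw [eq_coord_add b X, eq_coord_add b u, eq_coord_add b v]
  simp [areaForm_apply]
  ring

/-- An endomorphism acts on the area form through its trace. -/
theorem trace_mul_areaForm (A : E →L[ℝ] E) (X u : E) :
    LinearMap.trace ℝ E A * areaForm b X u = areaForm b (A X) u + areaForm b X (A u) := by
  rw [trace_eq_coord_add b]
  conv_rhs => rw [eq_coord_add b X, eq_coord_add b u]
  simp [areaForm_apply]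
  ring

namespace IsMetricOn

variable {G : E → E →L[ℝ] E →L[ℝ] ℝ} {U : Set E} (hG : IsMetricOn G U) {x : E}
include hG

include b in
/-- On a surface the Ricci tensor is a multiple of the metric: by its two skew
symmetries the curvature tensor has a single component. -/
theorem exists_ricci_eq (hx : x ∈ U) (hD : gramDet b (G x) ≠ 0) :
    ∃ K : ℝ, ∀ u v, ricci G x u v = K * G x u v := by
  -- `A v = R(e₀, e₁) v`; the single component of the curvature tensor is `κ`.
  set A : E → E := fun v => curvatureMap G x (b 1) v (b 0) with hA
  set κ : ℝ := G x (A (b 0)) (b 1) with hκ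
  have skew : ∀ v t, G x (A v) t = -G x (A t) v := fun v t =>
    hG.curvatureMap_skew hx (b 0) (b 1) v t
  have h00 : G x (A (b 0)) (b 0) = 0 := by linarith [skew (b 0) (b 0)]
  have h11 : G x (A (b 1)) (b 1) = 0 := by linarith [skew (b 1) (b 1)]
  have h10 : G x (A (b 1)) (b 0) = -κ := skew _ _
  have hself : ∀ v w, curvatureMap G x w v w = 0 := fun v w => by
    simp [curvatureMap]
  have hric : ∀ u v, ricci G x u v =
      b.coord 0 (A v) * b.coord 1 u - b.coord 1 (A v) * b.coord 0 u := by
    intro u v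
    have e0 : curvatureMap G x u v (b 0) = b.coord 1 u • A v := by
      rw [curvatureMap_swap, eq_coord_add b u, map_add, map_smul, map_smul, hself,
        curvatureMap_swap G x (b 0) v (b 1)]
      simp [hA]
    have e1 : curvatureMap G x u v (b 1) = -(b.coord 0 u • A v) := by
      rw [curvatureMap_swap, eq_coord_add b u, map_add, map_smul, map_smul, hself]
      simp [hA]
    rw [ricci, trace_eq_coord_add b, e0, e1]
    simp
    ring
  refine ⟨-κ / gramDet b (G x), fun u v => ?_⟩
  have hv0 : G x (A v) (b 0) = -κ * b.coord 1 v := by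
    rw [skew, eq_coord_add b v]
    simp [h00, ← hκ]
    ring
  have hv1 : G x (A v) (b 1) = κ * b.coord 0 v := by
    rw [skew, eq_coord_add b v]
    simp [h11, h10]
    ring
  rw [apply_eq_coord b] at hv0 hv1
  simp only [Module.Basis.coord_apply, Module.Basis.repr_self, Finsupp.single_eq_same,
    hG.symm x hx (b 1) (b 0)] at hv0 hv1
  rw [hric, apply_eq_coord b (G x) u v, hG.symm x hx (b 1) (b 0)]
  rw [div_mul_eq_mul_div, eq_div_iff hD, gramDet]
  simp at hv0 hv1 ⊢
  -- Cramer's rule for the components of `A v`.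
  linear_combination (b.repr u 1 * G x (b 1) (b 1) + b.repr u 0 * G x (b 0) (b 1)) * hv0
    - (b.repr u 1 * G x (b 0) (b 1) + b.repr u 0 * G x (b 0) (b 0)) * hv1

theorem fderiv_gramDet (hx : x ∈ U) (z : E) :
    fderiv ℝ (fun y => gramDet b (G y)) x z =
      2 * LinearMap.trace ℝ E (christoffel G x z : E →L[ℝ] E) * gramDet b (G x) := by
  have hd : ∀ i j, DifferentiableAt ℝ (fun y => G y (b i) (b j)) x := fun i j =>
    ((hG.differentiableAt hx).clm_apply (differentiableAt_const _)).clm_apply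
      (differentiableAt_const _)
  unfold gramDet
  rw [fderiv_fun_sub ((hd 0 0).fun_mul (hd 1 1)) ((hd 0 1).fun_pow 2),
    fderiv_fun_mul (hd 0 0) (hd 1 1), fderiv_fun_pow 2 (hd 0 1)]
  simp only [sub_apply, add_apply, smul_apply, fderiv_apply₂ (hG.differentiableAt hx),
    hG.fderiv_apply hx, smul_eq_mul]
  rw [trace_eq_coord_add b]
  have e : ∀ i, christoffel G x z (b i) = _ := fun i => eq_coord_add b (christoffel G x z (b i))
  rw [e 0, e 1]
  simp [hG.symm x hx (b 1) (b 0)]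
  ring

end IsMetricOn

/-- The one-form `*dW / |dW|²`, where `*` is the Hodge star of `G` for the orientation given
by `b`. -/
def conjugateForm (G : E → E →L[ℝ] E →L[ℝ] ℝ) (W : E → ℝ) (x : E) : E →L[ℝ] ℝ :=
  (√(gramDet b (G x)) / gradSq G W x) • areaForm b (metricGrad G W x)

namespace IsMetricOn

variable {G : E → E →L[ℝ] E →L[ℝ] ℝ} {U : Set E} (hG : IsMetricOn G U) {x : E} {W : E → ℝ}
include hG

theorem contDiffAt_conjugateForm (hx : x ∈ U) (hpos : ∀ u, u ≠ 0 → 0 < G x u u)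
    (hW : ContDiffAt ℝ ∞ W x) (hN : gradSq G W x ≠ 0) :
    ContDiffAt ℝ ∞ (conjugateForm b G W) x := by
  have hd : ∀ i j, ContDiffAt ℝ ∞ (fun y => G y (b i) (b j)) x := fun i j =>
    ((hG.contDiffAt hx).clm_apply contDiffAt_const).clm_apply contDiffAt_const
  have hD : ContDiffAt ℝ ∞ (fun y => gramDet b (G y)) x :=
    ((hd 0 0).mul (hd 1 1)).sub ((hd 0 1).pow 2)
  exact ((hD.sqrt (gramDet_pos b (hG.symm x hx) hpos).ne').div (hG.contDiffAt_gradSq hx hW) hN).smul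
    ((areaForm b).contDiff.contDiffAt.comp x (hG.contDiffAt_metricGrad hx hW))

/-- If the Hessian of `W` is a multiple of the metric, then `*dW / |dW|²` is closed. -/
theorem fderiv_conjugateForm_symm (hx : x ∈ U) (hpos : ∀ u, u ≠ 0 → 0 < G x u u)
    (hW : ContDiffAt ℝ ∞ W x) (hN : gradSq G W x ≠ 0) {φ : ℝ}
    (hφ : ∀ u v, hessian G W x u v = φ * G x u v) (u v : E) :
    fderiv ℝ (conjugateForm b G W) x u v = fderiv ℝ (conjugateForm b G W) x v u := by
  have hDpos := gramDet_pos b (hG.symm x hx) hpos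
  have hs := Real.sqrt_pos.2 hDpos
  have hd : ∀ i j, DifferentiableAt ℝ (fun y => G y (b i) (b j)) x := fun i j =>
    ((hG.differentiableAt hx).clm_apply (differentiableAt_const _)).clm_apply
      (differentiableAt_const _)
  have hD : DifferentiableAt ℝ (fun y => gramDet b (G y)) x :=
    ((hd 0 0).mul (hd 1 1)).sub ((hd 0 1).pow 2)
  have hNd : DifferentiableAt ℝ (gradSq G W) x :=
    (hG.contDiffAt_gradSq hx hW).differentiableAt (by simp)
  have hX := hG.differentiableAt_metricGrad hx hW
  set X := metricGrad G W x with hXdef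
  set s := √(gramDet b (G x)) with hsdef
  set N := gradSq G W x with hNdef
  have key : ∀ u v, fderiv ℝ (conjugateForm b G W) x u v =
      (s * LinearMap.trace ℝ E (christoffel G x u : E →L[ℝ] E) / N
        - s * (2 * φ * fderiv ℝ W x u) / N ^ 2) * areaForm b X v
      + s / N * (φ * areaForm b u v - areaForm b (christoffel G x u X) v) := by
    intro u v
    have hω : DifferentiableAt ℝ (conjugateForm b G W) x :=
      (hG.contDiffAt_conjugateForm b hx hpos hW hN).differentiableAt (by simp)
    have e1 : fderiv ℝ (fun y => conjugateForm b G W y v) x u =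
        fderiv ℝ (conjugateForm b G W) x u v := by
      rw [(hω.hasFDerivAt.clm_apply (hasFDerivAt_const v x)).fderiv]
      simp
    have hsq : HasFDerivAt (fun y => √(gramDet b (G y)))
        ((1 / (2 * s)) • fderiv ℝ (fun y => gramDet b (G y)) x) x :=
      hD.hasFDerivAt.sqrt hDpos.ne'
    have hA : HasFDerivAt (fun y => areaForm b (metricGrad G W y) v)
        ((((areaForm b).comp (fderiv ℝ (metricGrad G W) x)).flip v)) x := by
      have := ((areaForm b).hasFDerivAt.comp x hX.hasFDerivAt).clm_apply (hasFDerivAt_const v x)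
      simpa using this
    have hinv : HasFDerivAt (fun y => (gradSq G W y)⁻¹) (-(N ^ 2)⁻¹ • fderiv ℝ (gradSq G W) x) x :=
      (hasDerivAt_inv hN).comp_hasFDerivAt x hNd.hasFDerivAt
    have e2 := ((hsq.fun_mul hinv).fun_mul hA).fderiv
    rw [← e1]
    have e3 : (fun y => conjugateForm b G W y v) = fun y =>
        √(gramDet b (G y)) * (gradSq G W y)⁻¹ * areaForm b (metricGrad G W y) v := by
      ext y
      simp [conjugateForm, div_eq_mul_inv]
    rw [e3, e2]
    simp only [add_apply, smul_apply, smul_eq_mul, ContinuousLinearMap.flip_apply,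
      ContinuousLinearMap.comp_apply, hG.fderiv_metricGrad hx hW hφ, hG.fderiv_gradSq hx hW hφ,
      hG.fderiv_gramDet b hx, map_sub, map_smul, sub_apply]
    rw [← hXdef, ← hNdef, ← hsdef, show gramDet b (G x) = s ^ 2 from (Real.sq_sqrt hDpos.le).symm]
    field_simp
    ring
  have ht := fun u v => trace_mul_areaForm b (christoffel G x u) X v
  have hl := apply_mul_areaForm_sub b (fderiv ℝ W x) X u v
  have hNX : fderiv ℝ W x X = N := rfl
  have ha : areaForm b u v = -areaForm b v u := by simp [areaForm_apply]; ring
  rw [hNX] at hl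
  have h1 := ht u v
  have h2 := ht v u
  rw [hG.christoffel_symm hx v u] at h2
  rw [key u v, key v u, ha]
  field_simp
  linear_combination N * h1 - N * h2 + 2 * φ * hl

include b in
/-- A function `W` on a Riemannian surface with `∇dW` a multiple of the metric and `dW ≠ 0` is one
of two local coordinates `τ, W` in which the metric is `|dW|² dτ² + dW² / |dW|²`; here
`dτ = *dW / |dW|²`. -/
theorem exists_conjugate {x₀ : E} (hx₀ : x₀ ∈ U) (hpos : ∀ x ∈ U, ∀ u, u ≠ 0 → 0 < G x u u)
    (hW : ∀ x ∈ U, ContDiffAt ℝ ∞ W x) (hN : gradSq G W x₀ ≠ 0)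
    (hφ : ∀ x ∈ U, ∃ φ : ℝ, ∀ u v, hessian G W x u v = φ * G x u v) :
    ∃ V ⊆ U, IsOpen V ∧ x₀ ∈ V ∧ ∃ τ : E → ℝ, (∀ x ∈ V, ContDiffAt ℝ ∞ τ x) ∧
      ∀ x ∈ V, gradSq G W x ≠ 0 ∧ ∀ u v, G x u v =
        gradSq G W x * (fderiv ℝ τ x u * fderiv ℝ τ x v)
          + 1 / gradSq G W x * (fderiv ℝ W x u * fderiv ℝ W x v) := by
  obtain ⟨r, hr, hball⟩ := Metric.mem_nhds_iff.1 (Filter.inter_mem (hG.isOpen.mem_nhds hx₀)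
    ((hG.contDiffAt_gradSq hx₀ (hW x₀ hx₀)).continuousAt.eventually_ne hN))
  have hU : ∀ x ∈ Metric.ball x₀ r, x ∈ U := fun x hx => (hball hx).1
  have hN' : ∀ x ∈ Metric.ball x₀ r, gradSq G W x ≠ 0 := fun x hx => (hball hx).2
  let θ := conjugateForm b G W
  have hω : ∀ x ∈ Metric.ball x₀ r, ContDiffAt ℝ ∞ θ x := fun x hx =>
    hG.contDiffAt_conjugateForm b (hU x hx) (hpos x (hU x hx)) (hW x (hU x hx)) (hN' x hx)
  obtain ⟨τ, hτ⟩ := (convex_ball x₀ r).exists_forall_hasFDerivAt_of_fderiv_symmetric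
    Metric.isOpen_ball
    (show DifferentiableOn ℝ θ _ from fun x hx =>
      ((hω x hx).differentiableAt (by simp)).differentiableWithinAt)
    (fun x hx u v => by
      obtain ⟨φ, h⟩ := hφ x (hU x hx)
      exact hG.fderiv_conjugateForm_symm b (hU x hx) (hpos x (hU x hx)) (hW x (hU x hx)) (hN' x hx)
        h u v)
  have hτs : ContDiffOn ℝ ∞ τ (Metric.ball x₀ r) := by
    rw [contDiffOn_infty_iff_fderiv_of_isOpen Metric.isOpen_ball]
    refine ⟨fun x hx => (hτ x hx).differentiableAt.differentiableWithinAt, fun x hx => ?_⟩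
    exact ((hω x hx).contDiffWithinAt).congr (fun y hy => (hτ y hy).fderiv) (hτ x hx).fderiv
  refine ⟨_, hU, Metric.isOpen_ball, Metric.mem_ball_self hr, τ,
    fun x hx => hτs.contDiffAt (Metric.isOpen_ball.mem_nhds hx),
    fun x hx => ⟨hN' x hx, fun u v => ?_⟩⟩
  have hs := hG.symm x (hU x hx)
  have hD := gramDet_pos b hs (hpos x (hU x hx))
  have hL := gramDet_mul_areaForm_mul_areaForm b hs (metricGrad G W x) u v
  simp only [hG.apply_metricGrad (hU x hx)] at hL
  rw [(hτ x hx).fderiv]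
  have hNx := hN' x hx
  simp only [θ, conjugateForm, smul_apply, smul_eq_mul]
  change gramDet b (G x) * _ = gradSq G W x * _ - _ at hL
  rw [← Real.sq_sqrt hD.le] at hL
  field_simp
  linear_combination -hL

end IsMetricOn

end Surface

/-! ### Ricci curvature of a warped product -/

section WarpedRicci

variable {E₁ : Type*} [NormedAddCommGroup E₁] [NormedSpace ℝ E₁]
  {E₂ : Type*} [NormedAddCommGroup E₂] [NormedSpace ℝ E₂]

/-- The local form `g + W² h` of a warped product on a product of vector spaces. -/
def warpedForm (g : E₁ → E₁ →L[ℝ] E₁ →L[ℝ] ℝ) (W : E₁ → ℝ) (h : E₂ → E₂ →L[ℝ] E₂ →L[ℝ] ℝ)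
    (p : E₁ × E₂) : E₁ × E₂ →L[ℝ] E₁ × E₂ →L[ℝ] ℝ :=
  pullForm (ContinuousLinearMap.fst ℝ E₁ E₂) (g p.1) +
    W p.1 ^ 2 • pullForm (ContinuousLinearMap.snd ℝ E₁ E₂) (h p.2)

theorem warpedForm_apply (g : E₁ → E₁ →L[ℝ] E₁ →L[ℝ] ℝ) (W : E₁ → ℝ)
    (h : E₂ → E₂ →L[ℝ] E₂ →L[ℝ] ℝ) (p u v : E₁ × E₂) :
    warpedForm g W h p u v = g p.1 u.1 v.1 + W p.1 ^ 2 * h p.2 u.2 v.2 := rfl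

/-- The Laplacian `tr ∇ grad W` with respect to `G`. -/
def laplacian (G : E₁ → E₁ →L[ℝ] E₁ →L[ℝ] ℝ) (W : E₁ → ℝ) (x : E₁) : ℝ :=
  LinearMap.trace ℝ E₁ (fderiv ℝ (metricGrad G W) x +
    (christoffel G x).flip (metricGrad G W x) : E₁ →L[ℝ] E₁)

theorem trace_prod [FiniteDimensional ℝ E₁] [FiniteDimensional ℝ E₂]
    (f : E₁ × E₂ →ₗ[ℝ] E₁ × E₂) :
    LinearMap.trace ℝ (E₁ × E₂) f =
      LinearMap.trace ℝ E₁ (LinearMap.fst ℝ E₁ E₂ ∘ₗ f ∘ₗ LinearMap.inl ℝ E₁ E₂) +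
      LinearMap.trace ℝ E₂ (LinearMap.snd ℝ E₁ E₂ ∘ₗ f ∘ₗ LinearMap.inr ℝ E₁ E₂) := by
  have h : f = (f ∘ₗ LinearMap.inl ℝ E₁ E₂) ∘ₗ LinearMap.fst ℝ E₁ E₂ +
      (f ∘ₗ LinearMap.inr ℝ E₁ E₂) ∘ₗ LinearMap.snd ℝ E₁ E₂ := by
    ext u <;> simp [← Prod.zero_eq_mk]
  conv_lhs => rw [h]
  rw [map_add, LinearMap.trace_comp_comm', LinearMap.trace_comp_comm' _ (LinearMap.snd ℝ E₁ E₂)]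

theorem fderiv_comp_fst {F : Type*} [NormedAddCommGroup F] [NormedSpace ℝ F] {f : E₁ → F}
    {p : E₁ × E₂} (hf : DifferentiableAt ℝ f p.1) (z : E₁ × E₂) :
    fderiv ℝ (fun y : E₁ × E₂ => f y.1) p z = fderiv ℝ f p.1 z.1 := by
  exact DFunLike.congr_fun (F := E₁ × E₂ →L[ℝ] F) (hf.hasFDerivAt.comp p hasFDerivAt_fst).fderiv z

theorem fderiv_comp_snd {F : Type*} [NormedAddCommGroup F] [NormedSpace ℝ F] {f : E₂ → F}
    {p : E₁ × E₂} (hf : DifferentiableAt ℝ f p.2) (z : E₁ × E₂) :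
    fderiv ℝ (fun y : E₁ × E₂ => f y.2) p z = fderiv ℝ f p.2 z.2 := by
  exact DFunLike.congr_fun (F := E₁ × E₂ →L[ℝ] F) (hf.hasFDerivAt.comp p hasFDerivAt_snd).fderiv z

variable [FiniteDimensional ℝ E₁] [FiniteDimensional ℝ E₂]
  {g : E₁ → E₁ →L[ℝ] E₁ →L[ℝ] ℝ} {W : E₁ → ℝ} {h : E₂ → E₂ →L[ℝ] E₂ →L[ℝ] ℝ}
  {U₁ : Set E₁} {U₂ : Set E₂}

theorem isMetricOn_warpedForm (hg : IsMetricOn g U₁) (hh : IsMetricOn h U₂)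
    (hW : ∀ x ∈ U₁, ContDiffAt ℝ ∞ W x) (hW0 : ∀ x ∈ U₁, W x ≠ 0) :
    IsMetricOn (warpedForm g W h) (U₁ ×ˢ U₂) where
  isOpen := hg.isOpen.prod hh.isOpen
  contDiffOn := by
    rw [contDiffOn_clm_apply]
    intro u
    rw [contDiffOn_clm_apply]
    intro v p hp
    have h1 : ContDiffAt ℝ ∞ (fun p : E₁ × E₂ => g p.1 u.1 v.1) p :=
      (((hg.contDiffAt hp.1).comp p contDiffAt_fst).clm_apply contDiffAt_const).clm_apply
        contDiffAt_const
    have h2 : ContDiffAt ℝ ∞ (fun p : E₁ × E₂ => h p.2 u.2 v.2) p :=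
      (((hh.contDiffAt hp.2).comp p contDiffAt_snd).clm_apply contDiffAt_const).clm_apply
        contDiffAt_const
    exact (h1.add ((((hW _ hp.1).comp p contDiffAt_fst).pow 2).mul h2)).contDiffWithinAt
  symm p hp u v := by
    rw [warpedForm_apply, warpedForm_apply, hg.symm _ hp.1, hh.symm _ hp.2]
  nondeg p hp u hu := by
    refine Prod.ext (hg.nondeg _ hp.1 _ fun v => ?_) (hh.nondeg _ hp.2 _ fun v => ?_)
    · simpa [warpedForm_apply] using hu (v, 0)
    · simpa [warpedForm_apply, hW0 _ hp.1] using hu (0, v)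

variable (hg : IsMetricOn g U₁) (hh : IsMetricOn h U₂)
    (hW : ∀ x ∈ U₁, ContDiffAt ℝ ∞ W x) (hW0 : ∀ x ∈ U₁, W x ≠ 0)
include hg hh hW hW0

theorem fderiv_warpedForm {p : E₁ × E₂} (hp : p ∈ U₁ ×ˢ U₂) (z u v : E₁ × E₂) :
    fderiv ℝ (warpedForm g W h) p z u v =
      fderiv ℝ g p.1 z.1 u.1 v.1 + 2 * W p.1 * fderiv ℝ W p.1 z.1 * h p.2 u.2 v.2
        + W p.1 ^ 2 * fderiv ℝ h p.2 z.2 u.2 v.2 := by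
  have hG := isMetricOn_warpedForm hg hh hW hW0
  have hdg := hg.differentiableAt hp.1
  have hdh := hh.differentiableAt hp.2
  have hdW : DifferentiableAt ℝ W p.1 := (hW _ hp.1).differentiableAt (by simp)
  have h1 : DifferentiableAt ℝ (fun x => g x u.1 v.1) p.1 :=
    (hdg.clm_apply (differentiableAt_const _)).clm_apply (differentiableAt_const _)
  have h2 : DifferentiableAt ℝ (fun x => h x u.2 v.2) p.2 :=
    (hdh.clm_apply (differentiableAt_const _)).clm_apply (differentiableAt_const _)
  have h3 : DifferentiableAt ℝ (fun x => W x ^ 2) p.1 := hdW.pow 2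
  have e1 : DifferentiableAt ℝ (fun y : E₁ × E₂ => g y.1 u.1 v.1) p :=
    h1.comp p differentiableAt_fst
  have e2 : DifferentiableAt ℝ (fun y : E₁ × E₂ => h y.2 u.2 v.2) p :=
    h2.comp p differentiableAt_snd
  have e3 : DifferentiableAt ℝ (fun y : E₁ × E₂ => W y.1 ^ 2) p :=
    h3.comp p differentiableAt_fst
  rw [← fderiv_apply₂ (hG.differentiableAt hp)]
  simp only [warpedForm_apply]
  rw [fderiv_fun_add e1 (e3.fun_mul e2), fderiv_fun_mul e3 e2]
  simp only [add_apply, smul_apply, smul_eq_mul]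
  rw [fderiv_comp_fst h1, fderiv_comp_snd h2, fderiv_comp_fst h3, fderiv_apply₂ hdg,
    fderiv_apply₂ hdh, fderiv_fun_pow 2 hdW]
  simp
  ring

/-- The Levi-Civita connection of a warped product. -/
theorem christoffel_warpedForm {p : E₁ × E₂} (hp : p ∈ U₁ ×ˢ U₂) (u v : E₁ × E₂) :
    christoffel (warpedForm g W h) p u v =
      (christoffel g p.1 u.1 v.1 - (W p.1 * h p.2 u.2 v.2) • metricGrad g W p.1,
        christoffel h p.2 u.2 v.2 + (fderiv ℝ W p.1 u.1 / W p.1) • v.2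
          + (fderiv ℝ W p.1 v.1 / W p.1) • u.2) := by
  refine (isMetricOn_warpedForm hg hh hW hW0).christoffel_eq hp fun z => ?_
  have h0 := hW0 _ hp.1
  rw [christoffelLower_apply, fderiv_warpedForm hg hh hW hW0 hp, fderiv_warpedForm hg hh hW hW0 hp,
    fderiv_warpedForm hg hh hW hW0 hp, warpedForm_apply]
  simp only [map_add, map_sub, map_smul, add_apply, sub_apply, smul_apply, smul_eq_mul,
    hg.apply_christoffel hp.1, hh.apply_christoffel hp.2, hg.apply_metricGrad hp.1,
    christoffelLower_apply]
  field_simp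
  ring

theorem fst_fderiv_christoffel_warpedForm {p : E₁ × E₂} (hp : p ∈ U₁ ×ˢ U₂) (u v z : E₁ × E₂) :
    (fderiv ℝ (fun y => christoffel (warpedForm g W h) y u v) p z).1 =
      fderiv ℝ (fun y : E₁ × E₂ => christoffel g y.1 u.1 v.1
        - (W y.1 * h y.2 u.2 v.2) • metricGrad g W y.1) p z := by
  have hG := isMetricOn_warpedForm hg hh hW hW0
  have e := (hasFDerivAt_fst.comp p
    (hG.differentiableAt_christoffel_apply hp u v).hasFDerivAt).fderiv
  have e' : (fun y : E₁ × E₂ => christoffel g y.1 u.1 v.1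
        - (W y.1 * h y.2 u.2 v.2) • metricGrad g W y.1) =ᶠ[nhds p]
      Prod.fst ∘ fun y => christoffel (warpedForm g W h) y u v := by
    filter_upwards [hG.isOpen.mem_nhds hp] with y hy
    simp [christoffel_warpedForm hg hh hW hW0 hy]
  rw [e'.fderiv_eq, e]
  rfl

theorem snd_fderiv_christoffel_warpedForm {p : E₁ × E₂} (hp : p ∈ U₁ ×ˢ U₂) (u v z : E₁ × E₂) :
    (fderiv ℝ (fun y => christoffel (warpedForm g W h) y u v) p z).2 =
      fderiv ℝ (fun y : E₁ × E₂ => christoffel h y.2 u.2 v.2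
        + (fderiv ℝ W y.1 u.1 / W y.1) • v.2 + (fderiv ℝ W y.1 v.1 / W y.1) • u.2) p z := by
  have hG := isMetricOn_warpedForm hg hh hW hW0
  have e := (hasFDerivAt_snd.comp p
    (hG.differentiableAt_christoffel_apply hp u v).hasFDerivAt).fderiv
  have e' : (fun y : E₁ × E₂ => christoffel h y.2 u.2 v.2
        + (fderiv ℝ W y.1 u.1 / W y.1) • v.2 + (fderiv ℝ W y.1 v.1 / W y.1) • u.2) =ᶠ[nhds p]
      Prod.snd ∘ fun y => christoffel (warpedForm g W h) y u v := by
    filter_upwards [hG.isOpen.mem_nhds hp] with y hy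
    simp [christoffel_warpedForm hg hh hW hW0 hy]
  rw [e'.fderiv_eq, e]
  rfl

/-- The Ricci curvature of a warped product in the directions of the base. -/
theorem ricci_warpedForm_base {p : E₁ × E₂} (hp : p ∈ U₁ ×ˢ U₂) (u v : E₁) :
    ricci (warpedForm g W h) p (u, 0) (v, 0) =
      ricci g p.1 u v - Module.finrank ℝ E₂ / W p.1 * hessian g W p.1 u v := by
  have hG := isMetricOn_warpedForm hg hh hW hW0
  have h0 := hW0 _ hp.1
  have hdW : DifferentiableAt ℝ W p.1 := (hW _ hp.1).differentiableAt (by simp)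
  have hddW : DifferentiableAt ℝ (fderiv ℝ W) p.1 :=
    ((hW _ hp.1).fderiv_right (m := 1) (by norm_cast)).differentiableAt (by simp)
  have A : LinearMap.fst ℝ E₁ E₂ ∘ₗ curvatureMap (warpedForm g W h) p (u, 0) (v, 0) ∘ₗ
      LinearMap.inl ℝ E₁ E₂ = curvatureMap g p.1 u v := by
    ext z
    have hd := hg.differentiableAt_christoffel_apply hp.1
    simp only [LinearMap.comp_apply, LinearMap.inl_apply, LinearMap.fst_apply,
      hG.curvatureMap_apply hp, Prod.fst_add, Prod.fst_sub,
      fst_fderiv_christoffel_warpedForm hg hh hW hW0 hp, christoffel_warpedForm hg hh hW hW0 hp]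
    simp [fderiv_comp_fst (hd _ _), hg.curvatureMap_apply hp.1]
  have B : LinearMap.snd ℝ E₁ E₂ ∘ₗ curvatureMap (warpedForm g W h) p (u, 0) (v, 0) ∘ₗ
      LinearMap.inr ℝ E₁ E₂ = (-(hessian g W p.1 u v / W p.1)) • LinearMap.id := by
    ext z
    have hinv : HasFDerivAt (fun x => (W x)⁻¹) (-(W p.1 ^ 2)⁻¹ • fderiv ℝ W p.1) p.1 :=
      (hasDerivAt_inv h0).comp_hasFDerivAt p.1 hdW.hasFDerivAt
    have hq := (hddW.hasFDerivAt.clm_apply (hasFDerivAt_const v p.1)).fun_mul hinv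
    simp only [← div_eq_mul_inv] at hq
    have hq'' : DifferentiableAt ℝ (fun y : E₁ × E₂ => fderiv ℝ W y.1 v / W y.1) p :=
      DifferentiableAt.comp p hq.differentiableAt differentiableAt_fst
    simp only [LinearMap.comp_apply, LinearMap.inr_apply, LinearMap.snd_apply,
      hG.curvatureMap_apply hp, Prod.snd_add, Prod.snd_sub,
      snd_fderiv_christoffel_warpedForm hg hh hW hW0 hp, christoffel_warpedForm hg hh hW hW0 hp]
    simp only [map_zero, zero_apply, smul_zero, zero_div, zero_smul, zero_add, add_zero, mul_zero,
      sub_zero, fderiv_const_apply]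
    rw [fderiv_smul_const hq'', ContinuousLinearMap.smulRight_apply,
      fderiv_comp_fst hq.differentiableAt, hq.fderiv]
    simp [smul_smul, hessian]
    match_scalars
    field_simp
    ring
  rw [ricci, trace_prod, A, B, map_smul, LinearMap.trace_id, ← ricci]
  simp
  ring

/-- The Ricci curvature of a warped product in the directions of the fibre. -/
theorem ricci_warpedForm_fibre {p : E₁ × E₂} (hp : p ∈ U₁ ×ˢ U₂) (u v : E₂) :
    ricci (warpedForm g W h) p (0, u) (0, v) =
      ricci h p.2 u v - (W p.1 * laplacian g W p.1
        + (Module.finrank ℝ E₂ - 1) * gradSq g W p.1) * h p.2 u v := by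
  have hG := isMetricOn_warpedForm hg hh hW hW0
  have h0 := hW0 _ hp.1
  have hdW : DifferentiableAt ℝ W p.1 := (hW _ hp.1).differentiableAt (by simp)
  have hX := hg.differentiableAt_metricGrad hp.1 (hW _ hp.1)
  have A : LinearMap.fst ℝ E₁ E₂ ∘ₗ curvatureMap (warpedForm g W h) p (0, u) (0, v) ∘ₗ
      LinearMap.inl ℝ E₁ E₂ = (-(W p.1 * h p.2 u v)) • ((fderiv ℝ (metricGrad g W) p.1 +
    (christoffel g p.1).flip (metricGrad g W p.1) : E₁ →L[ℝ] E₁) : E₁ →ₗ[ℝ] E₁) := by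
    ext z
    have e : fderiv ℝ (fun y : E₁ × E₂ => (W y.1 * h y.2 u v) • metricGrad g W y.1) p (z, 0) =
        (W p.1 * h p.2 u v) • fderiv ℝ (metricGrad g W) p.1 z
          + (fderiv ℝ W p.1 z * h p.2 u v) • metricGrad g W p.1 := by
      have h2 : DifferentiableAt ℝ (fun x => h x u v) p.2 :=
        ((hh.differentiableAt hp.2).clm_apply (differentiableAt_const _)).clm_apply
          (differentiableAt_const _)
      have e2 : DifferentiableAt ℝ (fun y : E₁ × E₂ => h y.2 u v) p :=
        h2.comp p differentiableAt_snd
      have e3 : DifferentiableAt ℝ (fun y : E₁ × E₂ => W y.1) p :=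
        hdW.comp p differentiableAt_fst
      have e4 : DifferentiableAt ℝ (fun y : E₁ × E₂ => metricGrad g W y.1) p :=
        hX.comp p differentiableAt_fst
      rw [fderiv_fun_smul (e3.fun_mul e2) e4, fderiv_fun_mul e3 e2]
      simp [fderiv_comp_fst hX, fderiv_comp_fst hdW, fderiv_comp_snd h2, mul_comm]
    simp only [LinearMap.comp_apply, LinearMap.inl_apply, LinearMap.fst_apply,
      hG.curvatureMap_apply hp, Prod.fst_add, Prod.fst_sub,
      fst_fderiv_christoffel_warpedForm hg hh hW hW0 hp, christoffel_warpedForm hg hh hW hW0 hp]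
    simp [e]
    match_scalars
    all_goals field_simp
    all_goals ring
  have B : LinearMap.snd ℝ E₁ E₂ ∘ₗ curvatureMap (warpedForm g W h) p (0, u) (0, v) ∘ₗ
      LinearMap.inr ℝ E₁ E₂ = curvatureMap h p.2 u v - gradSq g W p.1 • (h p.2 u v • LinearMap.id
        - ((h p.2).flip v : E₂ →ₗ[ℝ] ℝ).smulRight u) := by
    ext z
    have hd := hh.differentiableAt_christoffel_apply hp.2
    simp only [LinearMap.comp_apply, LinearMap.inr_apply, LinearMap.snd_apply,
      hG.curvatureMap_apply hp, Prod.snd_add, Prod.snd_sub,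
      snd_fderiv_christoffel_warpedForm hg hh hW hW0 hp, christoffel_warpedForm hg hh hW hW0 hp]
    simp [fderiv_comp_snd (hd _ _), hh.curvatureMap_apply hp.2, gradSq]
    match_scalars
    all_goals field_simp
  rw [ricci, trace_prod, A, B, map_smul, map_sub, map_smul, map_sub, map_smul, LinearMap.trace_id,
    LinearMap.trace_smulRight, ← ricci, ← laplacian]
  simp
  ring

end WarpedRicci

/-- Scaling the metric by a constant changes neither the connection nor the Ricci tensor. -/
theorem ricci_smul {E : Type*} [NormedAddCommGroup E] [NormedSpace ℝ E] [FiniteDimensional ℝ E]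
    {G : E → E →L[ℝ] E →L[ℝ] ℝ} {U : Set E} (hG : IsMetricOn G U) {x : E} (hx : x ∈ U) {a : ℝ}
    (ha : a ≠ 0) (u v : E) : ricci (fun x => a • G x) x u v = ricci G x u v := by
  have haG : IsMetricOn (fun x => a • G x) U :=
    { isOpen := hG.isOpen
      contDiffOn := hG.contDiffOn.const_smul a
      symm := fun x hx u v => by simp [hG.symm x hx u v]
      nondeg := fun x hx u hu => hG.nondeg x hx u fun v => by simpa [ha] using hu v }
  have h : ∀ y ∈ U, ∀ u v, christoffel (fun x => a • G x) y u v = christoffel G y u v := by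
    intro y hy u v
    refine haG.christoffel_eq hy fun z => ?_
    have e : fderiv ℝ (fun x => a • G x) y = a • fderiv ℝ G y :=
      ((hG.differentiableAt hy).hasFDerivAt.const_smul a).fderiv
    rw [smul_apply, smul_apply, hG.apply_christoffel hy, christoffelLower_apply,
      christoffelLower_apply, e]
    simp
    ring
  have h' : ∀ u v, (fun y => christoffel (fun x => a • G x) y u v) =ᶠ[nhds x]
      fun y => christoffel G y u v := fun u v => by
    filter_upwards [hG.isOpen.mem_nhds hx] with y hy using h y hy u v
  rw [ricci, ricci]
  congr 1
  ext z
  rw [haG.curvatureMap_apply hx, hG.curvatureMap_apply hx]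
  simp only [h x hx, (h' _ _).fderiv_eq]

/-! ### The model surfaces -/

section Models

theorem isMetricOn_diagForm {a c : ℝ × ℝ → ℝ} (ha : ContDiff ℝ ∞ a) (hc : ContDiff ℝ ∞ c)
    (ha0 : ∀ q, a q ≠ 0) (hc0 : ∀ q, c q ≠ 0) :
    IsMetricOn (fun q => diagForm (a q) (c q)) Set.univ where
  isOpen := isOpen_univ
  contDiffOn := by
    unfold diagForm
    exact ((ha.smul contDiff_const).add (hc.smul contDiff_const)).contDiffOn
  symm q _ u v := by simp only [diagForm_apply]; ring
  nondeg q _ u hu := by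
    have h1 := hu (1, 0)
    have h2 := hu (0, 1)
    simp [diagForm_apply, ha0, hc0] at h1 h2
    exact Prod.ext h1 h2

theorem fderiv_diagForm {a c : ℝ × ℝ → ℝ} (ha : ContDiff ℝ ∞ a) (hc : ContDiff ℝ ∞ c)
    (q z u v : ℝ × ℝ) : fderiv ℝ (fun q => diagForm (a q) (c q)) q z u v =
      fderiv ℝ a q z * (u.1 * v.1) + fderiv ℝ c q z * (u.2 * v.2) := by
  have hda := ha.differentiable (by simp) q
  have hdc := hc.differentiable (by simp) q
  have h : DifferentiableAt ℝ (fun q => diagForm (a q) (c q)) q := by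
    unfold diagForm
    exact (hda.smul_const _).add (hdc.smul_const _)
  rw [← fderiv_apply₂ h]
  simp only [diagForm_apply]
  rw [fderiv_fun_add (hda.mul_const _) (hdc.mul_const _), fderiv_mul_const hda,
    fderiv_mul_const hdc]
  simp
  ring

/-- In a basis `e, f` with `∇_e e = 0`, `∇_f e = θ f` and `∂_e θ = 1 - θ²`, the Ricci curvature in
the direction `e` is `-1`. -/
theorem IsMetricOn.ricci_eq_neg_one {E : Type*} [NormedAddCommGroup E] [NormedSpace ℝ E]
    [FiniteDimensional ℝ E] (b : Module.Basis (Fin 2) ℝ E) {G : E → E →L[ℝ] E →L[ℝ] ℝ} {U : Set E}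
    (hG : IsMetricOn G U) {x : E} (hx : x ∈ U) {θ : E → ℝ} (hd : DifferentiableAt ℝ θ x)
    (h0 : ∀ y ∈ U, christoffel G y (b 0) (b 0) = 0)
    (h1 : ∀ y ∈ U, christoffel G y (b 1) (b 0) = θ y • b 1)
    (hθ : fderiv ℝ θ x (b 0) = 1 - θ x ^ 2) : ricci G x (b 0) (b 0) = -1 := by
  have hU := hG.isOpen.mem_nhds hx
  have e0 : (fun y => christoffel G y (b 0) (b 0)) =ᶠ[nhds x] fun _ => 0 := by
    filter_upwards [hU] with y hy using h0 y hy
  have e1 : (fun y => christoffel G y (b 1) (b 0)) =ᶠ[nhds x] fun y => θ y • b 1 := by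
    filter_upwards [hU] with y hy using h1 y hy
  have h1' : christoffel G x (b 0) (b 1) = θ x • b 1 := by rw [hG.christoffel_symm hx, h1 x hx]
  rw [ricci, trace_eq_coord_add b, hG.curvatureMap_apply hx, hG.curvatureMap_apply hx,
    e0.fderiv_eq, e1.fderiv_eq, fderiv_smul_const hd, h0 x hx, h1 x hx]
  simp [h1', hθ]
  ring

variable (k : ModelSurface)

/-- The metric of a model surface, as a field of bilinear forms on the vector space `ℝ²`. -/
def ModelSurface.form : ℝ × ℝ → ℝ × ℝ →L[ℝ] ℝ × ℝ →L[ℝ] ℝ := k.metric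

theorem ModelSurface.isMetricOn_form : IsMetricOn k.form Set.univ := by
  have hc := fun x => (Real.cosh_pos x).ne'
  have h1 : ContDiff ℝ ∞ fun q : ℝ × ℝ => Real.cosh q.1 ^ 2 :=
    (Real.contDiff_cosh.comp contDiff_fst).pow 2
  have h2 : ContDiff ℝ ∞ fun q : ℝ × ℝ => -Real.cosh q.2 ^ 2 :=
    ((Real.contDiff_cosh.comp contDiff_snd).pow 2).neg
  cases k
  · exact isMetricOn_diagForm contDiff_const contDiff_const (by simp) (by simp)
  · exact isMetricOn_diagForm contDiff_const h1 (by simp) (by simp [hc])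
  · exact isMetricOn_diagForm h2 contDiff_const (by simp [hc]) (by simp)

theorem ModelSurface.gramDet_form_ne_zero (q : ℝ × ℝ) :
    gramDet (Module.Basis.finTwoProd ℝ) (k.form q) ≠ 0 := by
  have hc := fun x => (Real.cosh_pos x).ne'
  cases k <;> simp [gramDet, form, metric, diagForm_apply, hc]

theorem hasFDerivAt_tanh_comp {E : Type*} [NormedAddCommGroup E] [NormedSpace ℝ E]
    (l : E →L[ℝ] ℝ) (x : E) :
    HasFDerivAt (fun y => Real.sinh (l y) / Real.cosh (l y))
      ((1 - (Real.sinh (l x) / Real.cosh (l x)) ^ 2) • l) x := by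
  have hc := (Real.cosh_pos (l x)).ne'
  have e : 1 - (Real.sinh (l x) / Real.cosh (l x)) ^ 2 = (Real.cosh (l x) * Real.cosh (l x)
      - Real.sinh (l x) * Real.sinh (l x)) / Real.cosh (l x) ^ 2 := by
    field_simp
  rw [e]
  exact ((Real.hasDerivAt_sinh (l x)).div (Real.hasDerivAt_cosh (l x)) hc).comp_hasFDerivAt x
    l.hasFDerivAt

/-- The model surfaces have constant curvature `k`. -/
theorem ModelSurface.ricci_form (q u v : ℝ × ℝ) :
    ricci k.form q u v = k.curvature * k.form q u v := by
  have hq : q ∈ Set.univ := Set.mem_univ q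
  obtain ⟨K, hK⟩ := k.isMetricOn_form.exists_ricci_eq (Module.Basis.finTwoProd ℝ) hq
    (k.gramDet_form_ne_zero q)
  have hG := k.isMetricOn_form
  have h1 : ContDiff ℝ ∞ fun q : ℝ × ℝ => Real.cosh q.1 ^ 2 :=
    (Real.contDiff_cosh.comp contDiff_fst).pow 2
  have h2 : ContDiff ℝ ∞ fun q : ℝ × ℝ => -Real.cosh q.2 ^ 2 :=
    ((Real.contDiff_cosh.comp contDiff_snd).pow 2).neg
  have hd1 : ∀ q z : ℝ × ℝ, fderiv ℝ (fun q : ℝ × ℝ => Real.cosh q.1 ^ 2) q z =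
      2 * Real.cosh q.1 * Real.sinh q.1 * z.1 := fun q z => by
    have h := ((Real.hasDerivAt_cosh q.1).fun_pow 2).comp_hasFDerivAt q
      (hasFDerivAt_fst (𝕜 := ℝ) (p := q))
    refine (DFunLike.congr_fun (F := ℝ × ℝ →L[ℝ] ℝ) h.fderiv z).trans ?_
    simp
  have hd2 : ∀ q z : ℝ × ℝ, fderiv ℝ (fun q : ℝ × ℝ => -Real.cosh q.2 ^ 2) q z =
      -(2 * Real.cosh q.2 * Real.sinh q.2 * z.2) := fun q z => by
    have h := ((Real.hasDerivAt_cosh q.2).fun_pow 2).fun_neg.comp_hasFDerivAt q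
      (hasFDerivAt_snd (𝕜 := ℝ) (p := q))
    refine (DFunLike.congr_fun (F := ℝ × ℝ →L[ℝ] ℝ) h.fderiv z).trans ?_
    simp
  -- One component of the Ricci tensor determines `K`.
  suffices h : K = k.curvature by rw [hK, h]
  cases k
  · have h0 : ∀ y u v, christoffel minkowski.form y u v = 0 := fun y u v =>
      hG.christoffel_eq (Set.mem_univ y) fun z => by
        have : fderiv ℝ minkowski.form y = 0 :=
          (hasFDerivAt_const (diagForm (-1) 1) y).fderiv
        simp [christoffelLower_apply, this]
    have h := hK (1, 0) (1, 0)
    have hR : curvatureMap minkowski.form q (1, 0) (1, 0) = 0 := by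
      ext <;> simp [hG.curvatureMap_apply hq, h0]
    rw [ricci, hR, map_zero] at h
    simpa [form, metric, diagForm_apply, curvature] using h
  · have hl : ∀ y u v z, christoffelLower deSitter.form y u v z =
        Real.cosh y.1 * Real.sinh y.1 * (u.1 * v.2 * z.2 + v.1 * u.2 * z.2 - z.1 * u.2 * v.2) := by
      intro y u v z
      have := fderiv_diagForm (contDiff_const (c := (-1 : ℝ))) h1 y
      rw [christoffelLower_apply]
      simp only [form, metric]
      rw [this, this, this, hd1, hd1, hd1]
      simp
      ring
    have h := hK (1, 0) (1, 0)
    have ht := hasFDerivAt_tanh_comp (ContinuousLinearMap.fst ℝ ℝ ℝ) q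
    have := hG.ricci_eq_neg_one (Module.Basis.finTwoProd ℝ) hq ht.differentiableAt
      (fun y hy => hG.christoffel_eq hy fun z => by rw [hl]; simp)
      (fun y hy => hG.christoffel_eq hy fun z => by
        have := (Real.cosh_pos y.1).ne'
        rw [hl]
        simp [form, metric, diagForm_apply]
        field_simp)
      (by rw [ht.fderiv]; simp)
    simp at this
    rw [this] at h
    simp [form, metric, diagForm_apply] at h
    simp [curvature]
    linarith
  · have hl : ∀ y u v z, christoffelLower antiDeSitter.form y u v z =
        -(Real.cosh y.2 * Real.sinh y.2) *
          (u.2 * v.1 * z.1 + v.2 * u.1 * z.1 - z.2 * u.1 * v.1) := by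
      intro y u v z
      have := fderiv_diagForm h2 (contDiff_const (c := (1 : ℝ))) y
      rw [christoffelLower_apply]
      simp only [form, metric]
      rw [this, this, this, hd2, hd2, hd2]
      simp
      ring
    have h := hK (0, 1) (0, 1)
    have ht := hasFDerivAt_tanh_comp (ContinuousLinearMap.snd ℝ ℝ ℝ) q
    have := hG.ricci_eq_neg_one ((Module.Basis.finTwoProd ℝ).reindex (Equiv.swap 0 1)) hq
      ht.differentiableAt
      (fun y hy => hG.christoffel_eq hy fun z => by rw [hl]; simp)
      (fun y hy => hG.christoffel_eq hy fun z => by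
        have := (Real.cosh_pos y.2).ne'
        rw [hl]
        simp [form, metric, diagForm_apply]
        field_simp)
      (by rw [ht.fderiv]; simp)
    simp at this
    rw [this] at h
    simp [form, metric, diagForm_apply] at h
    simp [curvature]
    linarith

end Models

/-! ### Local consequences of the Einstein equation -/

theorem ricci_congr {E : Type*} [NormedAddCommGroup E] [NormedSpace ℝ E]
    {G G' : E → E →L[ℝ] E →L[ℝ] ℝ} {x : E} (h : G =ᶠ[nhds x] G') : ricci G x = ricci G' x := by
  have hΓ : christoffel G =ᶠ[nhds x] christoffel G' := by
    filter_upwards [h.eventuallyEq_nhds] with y hy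
    rw [christoffel, christoffel, christoffelLower, christoffelLower, hy.fderiv_eq, hy.eq_of_nhds]
  ext u v
  rw [ricci, ricci]
  congr 1
  ext z
  simp only [curvatureMap, hΓ.fderiv_eq, hΓ.eq_of_nhds]

/-- A function satisfying a linear differential inequality `|dW| ≤ C |W - W(x₀)|` near `x₀` is
constant there. -/
theorem eq_of_sq_fderiv_le {E : Type*} [NormedAddCommGroup E] [NormedSpace ℝ E] {W : E → ℝ}
    {x₀ : E} {r C : ℝ} (hd : ∀ x ∈ Metric.ball x₀ r, DifferentiableAt ℝ W x)
    (h : ∀ x ∈ Metric.ball x₀ r, ∀ v, fderiv ℝ W x v ^ 2 ≤ (C * ‖v‖ * (W x - W x₀)) ^ 2)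
    {x : E} (hx : x ∈ Metric.ball x₀ r) : W x = W x₀ := by
  have hmem : ∀ s ∈ Set.Icc (0 : ℝ) 1, x₀ + s • (x - x₀) ∈ Metric.ball x₀ r := by
    intro s hs
    rw [mem_ball_iff_norm] at hx ⊢
    rw [add_sub_cancel_left, norm_smul, Real.norm_of_nonneg hs.1]
    exact (mul_le_of_le_one_left (norm_nonneg _) hs.2).trans_lt hx
  have hder : ∀ s ∈ Set.Icc (0 : ℝ) 1, HasDerivAt (fun s : ℝ => W (x₀ + s • (x - x₀)) - W x₀)
      (fderiv ℝ W (x₀ + s • (x - x₀)) (x - x₀)) s := by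
    intro s hs
    have hl : HasDerivAt (fun s : ℝ => x₀ + s • (x - x₀)) (x - x₀) s := by
      simpa using ((hasDerivAt_id s).smul_const (x - x₀)).const_add x₀
    exact ((hd _ (hmem s hs)).hasFDerivAt.comp_hasDerivAt s hl).sub_const _
  -- Gronwall's inequality on the segment from `x₀` to `x`.
  have := eq_zero_of_abs_deriv_le_mul_abs_self_of_eq_zero_right (K := |C| * ‖x - x₀‖)
    (fun s hs => (hder s hs).continuousAt.continuousWithinAt)
    (fun s hs => (hder s ⟨hs.1, hs.2.le⟩).hasDerivWithinAt) (by simp)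
    (fun s hs => by
      have := sq_le_sq.1 (h _ (hmem s ⟨hs.1, hs.2.le⟩) (x - x₀))
      rwa [abs_mul, abs_mul, abs_norm] at this)
    1 (Set.right_mem_Icc.2 zero_le_one)
  simpa [sub_eq_zero] using this

section LocalEinstein

variable {E : Type*} [NormedAddCommGroup E] [NormedSpace ℝ E]

/-- The data of an Einstein warped product `g + W² γ₀^{(k)}` over an open piece `U` of a
Riemannian surface. -/
structure IsEinsteinOn (g : E → E →L[ℝ] E →L[ℝ] ℝ) (W : E → ℝ) (k : ModelSurface) (Λ : ℝ)
    (U : Set E) : Prop where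
  isMetricOn : IsMetricOn g U
  pos : ∀ x ∈ U, ∀ u, u ≠ 0 → 0 < g x u u
  contDiffAt : ∀ x ∈ U, ContDiffAt ℝ ∞ W x
  ne_zero : ∀ x ∈ U, W x ≠ 0
  ricci_eq : ∀ x ∈ U, ∀ q u v,
    ricci (warpedForm g W k.form) (x, q) u v = Λ * warpedForm g W k.form (x, q) u v

/-- The quantity `W |dW|² - k W + Λ W³ / 3`, which is constant for an Einstein warped product. -/
def kottlerConst (k : ModelSurface) (Λ W N : ℝ) : ℝ :=
  W * N - k.curvature * W + Λ / 3 * W ^ 3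

namespace IsEinsteinOn

variable [FiniteDimensional ℝ E] (b : Module.Basis (Fin 2) ℝ E)
  {g : E → E →L[ℝ] E →L[ℝ] ℝ} {W : E → ℝ} {k : ModelSurface} {Λ : ℝ} {U : Set E}
  (h : IsEinsteinOn g W k Λ U) {x : E} (hx : x ∈ U)
include h hx

/-- The Einstein equation in the directions of the base. -/
theorem ricci_base (u v : E) :
    ricci g x u v - 2 / W x * hessian g W x u v = Λ * g x u v := by
  have := h.ricci_eq x hx 0 (u, 0) (v, 0)
  rw [ricci_warpedForm_base h.isMetricOn k.isMetricOn_form h.contDiffAt h.ne_zero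
    ⟨hx, Set.mem_univ _⟩, warpedForm_apply] at this
  simpa using this

/-- The Einstein equation in the directions of the fibre. -/
theorem ricci_fibre :
    k.curvature - W x * laplacian g W x - gradSq g W x = Λ * W x ^ 2 := by
  have key : ∀ u, k.form 0 u u ≠ 0 →
      k.curvature - W x * laplacian g W x - gradSq g W x = Λ * W x ^ 2 := by
    intro u hu
    have := h.ricci_eq x hx 0 (0, u) (0, u)
    rw [ricci_warpedForm_fibre h.isMetricOn k.isMetricOn_form h.contDiffAt h.ne_zero
      ⟨hx, Set.mem_univ _⟩, warpedForm_apply, k.ricci_form] at this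
    simp at this
    apply mul_right_cancel₀ hu
    linarith
  refine key (1, 0) ?_
  cases k <;> simp [ModelSurface.form, ModelSurface.metric, diagForm_apply]

include b

/-- The base equation says that the Hessian of `W` is a multiple of the metric, and the fibre
equation gives the factor. -/
theorem hessian_eq (u v : E) :
    hessian g W x u v =
      (k.curvature - gradSq g W x - Λ * W x ^ 2) / (2 * W x) * g x u v := by
  have h0 := h.ne_zero x hx
  obtain ⟨K, hK⟩ := h.isMetricOn.exists_ricci_eq b hx
    (gramDet_pos b (h.isMetricOn.symm x hx) (h.pos x hx)).ne'
  have hess : ∀ u v, hessian g W x u v = W x / 2 * (K - Λ) * g x u v := by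
    intro u v
    have := h.ricci_base hx u v
    rw [hK] at this
    field_simp at this
    linarith
  have hlap : laplacian g W x = W x * (K - Λ) := by
    have e : (fderiv ℝ (metricGrad g W) x + (christoffel g x).flip (metricGrad g W x) : E →L[ℝ] E)
        = (W x / 2 * (K - Λ)) • ContinuousLinearMap.id ℝ E := by
      ext z
      rw [add_apply, h.isMetricOn.fderiv_metricGrad hx (h.contDiffAt x hx) hess]
      simp
    have e2 : Module.finrank ℝ E = 2 := by simp [Module.finrank_eq_card_basis b]
    rw [laplacian, e, ContinuousLinearMap.toLinearMap_smul, map_smul, ContinuousLinearMap.coe_id,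
      LinearMap.trace_id, e2]
    simp
    ring
  have hf := h.ricci_fibre hx
  rw [hlap] at hf
  rw [hess]
  congr 1
  field_simp
  linarith

theorem hasFDerivAt_kottlerConst :
    HasFDerivAt (fun y => kottlerConst k Λ (W y) (gradSq g W y)) (0 : E →L[ℝ] ℝ) x := by
  have h0 := h.ne_zero x hx
  have hd := ((h.contDiffAt x hx).differentiableAt (by simp)).hasFDerivAt
  have hN := ((h.isMetricOn.contDiffAt_gradSq hx (h.contDiffAt x hx)).differentiableAt
    (by simp)).hasFDerivAt
  have h3 : HasFDerivAt (fun y => W y ^ 3) ((3 * W x ^ 2) • fderiv ℝ W x) x :=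
    ((hasDerivAt_pow 3 (W x)).comp_hasFDerivAt x hd).congr_fderiv (by simp)
  have := ((hd.fun_mul hN).fun_sub (hd.const_mul k.curvature)).fun_add
    (h3.const_mul (Λ / 3))
  refine this.congr_fderiv ?_
  refine ContinuousLinearMap.ext fun v => ?_
  simp [h.isMetricOn.fderiv_gradSq hx (h.contDiffAt x hx) (h.hessian_eq b hx)]
  field_simp
  ring

theorem eventually_kottlerConst_eq :
    ∀ᶠ y in nhds x, kottlerConst k Λ (W y) (gradSq g W y) =
      kottlerConst k Λ (W x) (gradSq g W x) := by
  obtain ⟨r, hr, hU⟩ := Metric.mem_nhds_iff.1 (h.isMetricOn.isOpen.mem_nhds hx)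
  filter_upwards [Metric.ball_mem_nhds x hr] with y hy
  exact (convex_ball x r).is_const_of_fderivWithin_eq_zero (𝕜 := ℝ)
    (fun z hz => (h.hasFDerivAt_kottlerConst b (hU hz)).differentiableAt.differentiableWithinAt)
    (fun z hz => by
      rw [fderivWithin_of_isOpen Metric.isOpen_ball hz,
        (h.hasFDerivAt_kottlerConst b (hU hz)).fderiv])
    hy (Metric.mem_ball_self hr)

/-- Cauchy–Schwarz: `dW(v)² ≤ |dW|² |v|²`. -/
theorem sq_fderiv_le (v : E) : fderiv ℝ W x v ^ 2 ≤ gradSq g W x * g x v v := by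
  have hs := h.isMetricOn.symm x hx
  have := gramDet_mul_areaForm_mul_areaForm b hs (metricGrad g W x) v v
  simp only [h.isMetricOn.apply_metricGrad hx] at this
  have h2 := mul_nonneg (gramDet_pos b hs (h.pos x hx)).le
    (mul_self_nonneg (areaForm b (metricGrad g W x) v))
  change _ = gradSq g W x * _ - _ at this
  nlinarith

/-- A critical point of `W` at which the Hessian vanishes too is surrounded by points where `W`
is constant: the conserved quantity makes `|dW|²` vanish to second order in `W - W(x)`. -/
theorem eventually_eq_of_degenerate (hd : fderiv ℝ W x = 0) (hk : k.curvature = Λ * W x ^ 2) :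
    ∀ᶠ y in nhds x, W y = W x := by
  have h0 := h.ne_zero x hx
  have hN : gradSq g W x = 0 := by simp [gradSq, hd]
  have hcW := (h.contDiffAt x hx).continuousAt
  -- `C` bounds the factor in `|dW|² |v|² = -(Λ / 3) (W - W(x))² (W + 2 W(x)) / W |v|²`.
  have hcont : ContinuousAt (fun y => ‖Λ / 3 * (W y + 2 * W x) / W y‖ * ‖g y‖) x :=
    (((hcW.add continuousAt_const).const_mul _).div hcW h0).norm.mul
      (h.isMetricOn.contDiffAt hx).continuousAt.norm
  set C := ‖Λ / 3 * (W x + 2 * W x) / W x‖ * ‖g x‖ + 1 with hC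
  have hC0 : 0 ≤ C := by positivity
  have hbound : ∀ᶠ y in nhds x, ‖Λ / 3 * (W y + 2 * W x) / W y‖ * ‖g y‖ < C :=
    hcont.eventually_lt continuousAt_const (lt_add_one _)
  obtain ⟨r, hr, hball⟩ := Metric.eventually_nhds_iff_ball.1
    (((h.isMetricOn.isOpen.eventually_mem hx).and hbound).and
      (h.eventually_kottlerConst_eq b hx))
  filter_upwards [Metric.ball_mem_nhds x hr] with y hy
  refine eq_of_sq_fderiv_le (C := √C)
    (fun y hy => (h.contDiffAt y (hball y hy).1.1).differentiableAt (by simp)) ?_ hy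
  intro y hy v
  obtain ⟨⟨hyU, hyC⟩, hyc⟩ := hball y hy
  have hy0 := h.ne_zero y hyU
  have hNy : gradSq g W y = -(Λ / 3 * (W y + 2 * W x) / W y) * (W y - W x) ^ 2 := by
    rw [kottlerConst, kottlerConst, hN, hk] at hyc
    field_simp
    linear_combination 3 * hyc
  refine (h.sq_fderiv_le b hyU v).trans ?_
  have hgv : |g y v v| ≤ ‖g y‖ * ‖v‖ * ‖v‖ := (g y).le_opNorm₂ v v
  calc gradSq g W y * g y v v
      ≤ |gradSq g W y * g y v v| := le_abs_self _
    _ = ‖Λ / 3 * (W y + 2 * W x) / W y‖ * (W y - W x) ^ 2 * |g y v v| := by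
        rw [abs_mul, hNy, abs_mul, abs_neg, abs_of_nonneg (sq_nonneg (W y - W x)), Real.norm_eq_abs]
    _ ≤ ‖Λ / 3 * (W y + 2 * W x) / W y‖ * (W y - W x) ^ 2 * (‖g y‖ * ‖v‖ * ‖v‖) := by gcongr
    _ = (‖Λ / 3 * (W y + 2 * W x) / W y‖ * ‖g y‖) * ((W y - W x) ^ 2 * ‖v‖ ^ 2) := by ring
    _ ≤ C * ((W y - W x) ^ 2 * ‖v‖ ^ 2) := by gcongr
    _ = (√C * ‖v‖ * (W y - W x)) ^ 2 := by rw [mul_pow, mul_pow, Real.sq_sqrt hC0]; ring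

/-- Where `dW` vanishes identically, the Hessian does too, so its factor in `hessian_eq` is `0`. -/
theorem degenerate_of_eventually_fderiv_eq_zero (hd : ∀ᶠ y in nhds x, fderiv ℝ W y = 0) :
    k.curvature = Λ * W x ^ 2 := by
  have h0 := h.ne_zero x hx
  have hess : ∀ u v, hessian g W x u v = 0 := fun u v => by
    have : fderiv ℝ (fderiv ℝ W) x = 0 := by
      rw [Filter.EventuallyEq.fderiv_eq (f := fun _ => (0 : E →L[ℝ] ℝ)) hd]
      simp
    simp [hessian, this, hd.self_of_nhds]
  have hN : gradSq g W x = 0 := by simp [gradSq, hd.self_of_nhds]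
  have := h.hessian_eq b hx (b 0) (b 0)
  rw [hess, hN, eq_comm, mul_eq_zero, or_iff_left (h.pos x hx _ (b.ne_zero 0)).ne',
    div_eq_zero_iff, or_iff_left (by simpa using h0)] at this
  linarith

omit b in
theorem ricci_of_eventually_fderiv_eq_zero (hd : ∀ᶠ y in nhds x, fderiv ℝ W y = 0) (u v : E) :
    ricci g x u v = Λ * g x u v := by
  have hess : hessian g W x u v = 0 := by
    have : fderiv ℝ (fderiv ℝ W) x = 0 := by
      rw [Filter.EventuallyEq.fderiv_eq (f := fun _ => (0 : E →L[ℝ] ℝ)) hd]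
      simp
    simp [hessian, this, hd.self_of_nhds]
  have := h.ricci_base hx u v
  rwa [hess, mul_zero, sub_zero] at this

omit [FiniteDimensional ℝ E] b hx in
/-- The squared length of `dW` is the function `k + c / W - Λ W² / 3`. -/
theorem gradSq_eq (hx : x ∈ U) {c : ℝ} (hc : kottlerConst k Λ (W x) (gradSq g W x) = c) :
    gradSq g W x = kottlerFun k.curvature c Λ (W x) := by
  have h0 := h.ne_zero x hx
  rw [← hc, kottlerConst, kottlerFun]
  field_simp
  ring

end IsEinsteinOn

end LocalEinstein

/-! ### Charts -/

section Charts

variable {E : Type*} [NormedAddCommGroup E] [NormedSpace ℝ E]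
  {H : Type*} [TopologicalSpace H] {I : ModelWithCorners ℝ E H} [I.Boundaryless]
  {M : Type*} [TopologicalSpace M] [ChartedSpace H M] [IsManifold I ∞ M] {p : M} {x : E}

theorem contMDiffAt_extChartAt_symm (hx : x ∈ (extChartAt I p).target) :
    ContMDiffAt 𝓘(ℝ, E) I ∞ (extChartAt I p).symm x :=
  (contMDiffOn_extChartAt_symm p).contMDiffAt ((isOpen_extChartAt_target p).mem_nhds hx)

theorem mdifferentiableAt_extChartAt_symm (hx : x ∈ (extChartAt I p).target) :
    MDifferentiableAt 𝓘(ℝ, E) I (extChartAt I p).symm x :=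
  (contMDiffAt_extChartAt_symm hx).mdifferentiableAt (by simp)

theorem isInvertible_mfderiv_extChartAt_symm (hx : x ∈ (extChartAt I p).target) :
    (mfderiv 𝓘(ℝ, E) I (extChartAt I p).symm x).IsInvertible := by
  have : IsManifold I 1 M := IsManifold.of_le (n := ∞) (by simp)
  have := isInvertible_mfderivWithin_extChartAt_symm (I := I) hx
  rwa [I.range_eq_univ, mfderivWithin_univ] at this

omit [I.Boundaryless] [IsManifold I ∞ M] in
theorem inChart_apply (G : BilinField I M) (p : M) (x u v : E) :
    inChart I G p x u v = G ((extChartAt I p).symm x)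
      (mfderiv 𝓘(ℝ, E) I (extChartAt I p).symm x u)
      (mfderiv 𝓘(ℝ, E) I (extChartAt I p).symm x v) := rfl

theorem contDiffAt_comp_extChartAt_symm {w : M → ℝ} (hw : ContMDiff I 𝓘(ℝ, ℝ) ∞ w)
    (hx : x ∈ (extChartAt I p).target) : ContDiffAt ℝ ∞ (w ∘ (extChartAt I p).symm) x :=
  contMDiffAt_iff_contDiffAt.1 (hw.contMDiffAt.comp x (contMDiffAt_extChartAt_symm hx))

theorem fderiv_comp_extChartAt_symm {w : M → ℝ} (hw : ContMDiff I 𝓘(ℝ, ℝ) ∞ w)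
    (hx : x ∈ (extChartAt I p).target) :
    fderiv ℝ (w ∘ (extChartAt I p).symm) x =
      (mfderiv I 𝓘(ℝ, ℝ) w ((extChartAt I p).symm x)).comp
        (mfderiv 𝓘(ℝ, E) I (extChartAt I p).symm x) := by
  rw [← mfderiv_eq_fderiv]
  exact mfderiv_comp x (hw.mdifferentiableAt (by simp)) (mdifferentiableAt_extChartAt_symm hx)

theorem comp_eq_zero_iff_of_isInvertible {E' : Type*} [NormedAddCommGroup E'] [NormedSpace ℝ E']
    {A : E →L[ℝ] E'} (hA : A.IsInvertible) {l : E' →L[ℝ] ℝ} : l.comp A = 0 ↔ l = 0 := by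
  obtain ⟨e, rfl⟩ := hA
  refine ⟨fun h => ?_, fun h => by simp [h]⟩
  ext v
  simpa using DFunLike.congr_fun h (e.symm v)

theorem fderiv_comp_extChartAt_symm_eq_zero_iff {w : M → ℝ} (hw : ContMDiff I 𝓘(ℝ, ℝ) ∞ w)
    (hx : x ∈ (extChartAt I p).target) :
    fderiv ℝ (w ∘ (extChartAt I p).symm) x = 0 ↔
      mfderiv I 𝓘(ℝ, ℝ) w ((extChartAt I p).symm x) = 0 := by
  rw [fderiv_comp_extChartAt_symm hw hx]
  exact comp_eq_zero_iff_of_isInvertible (E := E) (E' := E)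
    (isInvertible_mfderiv_extChartAt_symm hx)

/-- The components of a smooth Riemannian metric in a chart are smooth. -/
theorem contDiffAt_inChart_inner_apply
    (γ : Bundle.ContMDiffRiemannianMetric I ∞ E (fun p : M => TangentSpace I p))
    (hx : x ∈ (extChartAt I p).target) (u v : E) :
    ContDiffAt ℝ ∞ (fun y => inChart I γ.inner p y u v) x := by
  have hopen := isOpen_extChartAt_target (I := I) p
  have hvec : ∀ u : E, ContMDiffAt 𝓘(ℝ, E) I.tangent ∞
      (fun y => (⟨(extChartAt I p).symm y, mfderiv 𝓘(ℝ, E) I (extChartAt I p).symm y u⟩ :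
        TangentBundle I M)) x := by
    intro u
    have : IsManifold I 1 M := IsManifold.of_le (n := ∞) (by simp)
    have hT := (contMDiffOn_extChartAt_symm (I := I) (n := ∞) p).contMDiffOn_tangentMapWithin
      (m := ∞) (by simp) hopen.uniqueMDiffOn
    have hs : ContMDiffAt 𝓘(ℝ, E) 𝓘(ℝ, E).tangent ∞
        (fun y => (⟨y, u⟩ : TangentBundle 𝓘(ℝ, E) E)) x :=
      contMDiffAt_vectorSpace_iff_contDiffAt.2 contDiffAt_const
    have hc := (hT.contMDiffAt (x := (⟨x, u⟩ : TangentBundle 𝓘(ℝ, E) E))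
      ((hopen.preimage (FiberBundle.continuous_proj E _)).mem_nhds hx)).comp x hs
    refine hc.congr_of_eventuallyEq ?_
    filter_upwards [hopen.mem_nhds hx] with y hy
    simp only [Function.comp_apply, tangentMapWithin]
    rw [mfderivWithin_of_isOpen hopen hy]
  have hγ := γ.contMDiff.contMDiffAt.comp x (contMDiffAt_extChartAt_symm (I := I) hx)
  have := ContMDiffAt.clm_bundle_apply₂ (F₁ := E) (F₂ := E) (F₃ := ℝ)
    (E₃ := Bundle.Trivial M ℝ) hγ (hvec u) (hvec v)
  simp only [Bundle.contMDiffAt_totalSpace] at this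
  exact contMDiffAt_iff_contDiffAt.1 this.2

theorem inChart_inner_pos
    (γ : Bundle.ContMDiffRiemannianMetric I ∞ E (fun p : M => TangentSpace I p))
    (hx : x ∈ (extChartAt I p).target) {u : E} (hu : u ≠ 0) :
    0 < inChart I γ.inner p x u u := by
  refine γ.pos _ _ fun h => hu ?_
  obtain ⟨e, he⟩ := isInvertible_mfderiv_extChartAt_symm hx
  rw [← he] at h
  exact e.map_eq_zero_iff.1 h

theorem isMetricOn_inChart_inner [FiniteDimensional ℝ E]
    (γ : Bundle.ContMDiffRiemannianMetric I ∞ E (fun p : M => TangentSpace I p)) (p : M) :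
    IsMetricOn (inChart I γ.inner p) (extChartAt I p).target where
  isOpen := isOpen_extChartAt_target p
  contDiffOn := by
    rw [contDiffOn_clm_apply]
    intro u
    rw [contDiffOn_clm_apply]
    exact fun v x hx => (contDiffAt_inChart_inner_apply γ hx u v).contDiffWithinAt
  symm x _ u v := by
    rw [inChart_apply, inChart_apply]
    exact γ.symm _ _ _
  nondeg x hx u hu := by
    by_contra h
    exact (inChart_inner_pos γ hx h).ne' (hu u)

/-- The squared length of `dw` with respect to `G`. -/
def normSqDeriv (G : BilinField I M) (w : M → ℝ) (p : M) : ℝ :=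
  let l : E →L[ℝ] ℝ := mfderiv I 𝓘(ℝ, ℝ) w p
  let B : E →L[ℝ] E →L[ℝ] ℝ := G p
  l (ContinuousLinearMap.inverse B l)

/-- The squared length of a covector is invariant under linear isomorphisms. -/
theorem apply_inverse_pullForm {E' : Type*} [NormedAddCommGroup E'] [NormedSpace ℝ E']
    [FiniteDimensional ℝ E'] [FiniteDimensional ℝ E]
    {B : E' →L[ℝ] E' →L[ℝ] ℝ} (hB : ∀ u, (∀ v, B u v = 0) → u = 0) (A : E ≃L[ℝ] E')
    (l : E' →L[ℝ] ℝ) :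
    (l.comp (A : E →L[ℝ] E'))
        (ContinuousLinearMap.inverse (pullForm (A : E →L[ℝ] E') B) (l.comp (A : E →L[ℝ] E'))) =
      l (ContinuousLinearMap.inverse B l) := by
  have hA : ∀ u, (∀ v, pullForm (A : E →L[ℝ] E') B u v = 0) → u = 0 := fun u hu => by
    have := hB (A u) fun v => by simpa [pullForm] using hu (A.symm v)
    simpa using this
  rw [ContinuousLinearMap.comp_apply]
  congr 1
  refine eq_of_nondegenerate hB fun v => ?_
  rw [apply_inverse_of_nondegenerate hB]
  have := DFunLike.congr_fun
    (apply_inverse_of_nondegenerate hA (l.comp (A : E →L[ℝ] E'))) (A.symm v)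
  simpa [pullForm] using this

/-- `|dw|²` may be computed in any chart. -/
theorem gradSq_inChart [FiniteDimensional ℝ E]
    (γ : Bundle.ContMDiffRiemannianMetric I ∞ E (fun p : M => TangentSpace I p))
    {w : M → ℝ} (hw : ContMDiff I 𝓘(ℝ, ℝ) ∞ w) (hx : x ∈ (extChartAt I p).target) :
    gradSq (inChart I γ.inner p) (w ∘ (extChartAt I p).symm) x =
      normSqDeriv γ.inner w ((extChartAt I p).symm x) := by
  obtain ⟨e, he⟩ := isInvertible_mfderiv_extChartAt_symm hx
  have hB : ∀ u : E, (∀ v : E, γ.inner ((extChartAt I p).symm x) u v = 0) → u = 0 := by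
    intro u hu
    by_contra h
    exact (γ.pos _ _ h).ne' (hu u)
  have h1 := fderiv_comp_extChartAt_symm hw hx
  have h2 : inChart I γ.inner p x = pullForm (E := E) (E' := E)
    (mfderiv 𝓘(ℝ, E) I (extChartAt I p).symm x) (γ.inner ((extChartAt I p).symm x)) := rfl
  rw [gradSq, metricGrad, h1, h2, ← he]
  exact apply_inverse_pullForm (E := E) (E' := E) hB e _

end Charts

/-! ### Products and critical points -/

section Product

variable {E : Type*} [NormedAddCommGroup E] [NormedSpace ℝ E]
  {H : Type*} [TopologicalSpace H] {I : ModelWithCorners ℝ E H}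
  {M : Type*} [TopologicalSpace M] [ChartedSpace H M]
  {E' : Type*} [NormedAddCommGroup E'] [NormedSpace ℝ E']
  {H' : Type*} [TopologicalSpace H'] {J : ModelWithCorners ℝ E' H'}
  {N : Type*} [TopologicalSpace N] [ChartedSpace H' N]
  {E'' : Type*} [NormedAddCommGroup E''] [NormedSpace ℝ E'']
  {H'' : Type*} [TopologicalSpace H''] {K : ModelWithCorners ℝ E'' H''}
  {P : Type*} [TopologicalSpace P] [ChartedSpace H'' P]

theorem warpedProduct_apply (γ : BilinField I M) (w : M → ℝ) (γ' : BilinField J N) (m : M × N)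
    (u v : E × E') :
    warpedProduct I J γ w γ' m u v = γ m.1 u.1 v.1 + w m.1 ^ 2 * γ' m.2 u.2 v.2 := by
  unfold warpedProduct pullback
  rw [mfderiv_fst, mfderiv_snd]
  rfl

theorem pullback_warpedProduct_apply (γ : BilinField I M) (w : M → ℝ) (γ' : BilinField J N)
    {F : P → M × N} {z : P} {A : E'' →L[ℝ] E} {B : E'' →L[ℝ] E'}
    (hF : HasMFDerivAt K (I.prod J) F z (A.prod B : E'' →L[ℝ] E × E')) (u v : E'') :
    pullback K (I.prod J) F (warpedProduct I J γ w γ') z u v =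
      γ (F z).1 (A u) (A v) + w (F z).1 ^ 2 * γ' (F z).2 (B u) (B v) := by
  unfold pullback
  rw [hF.mfderiv]
  exact warpedProduct_apply γ w γ' (F z) (A u, B u) (A v, B v)

/-- In a product chart, a warped product with a vector space is a warped product of forms. -/
theorem inChart_warpedProduct [I.Boundaryless] [IsManifold I ∞ M] (γ : BilinField I M) (w : M → ℝ)
    (γ' : BilinField 𝓘(ℝ, E') E') (p : M) (q : E') {x : E} (hx : x ∈ (extChartAt I p).target)
    (y : E') :
    inChart (I.prod 𝓘(ℝ, E')) (warpedProduct I 𝓘(ℝ, E') γ w γ') (p, q) (x, y) =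
      warpedForm (inChart I γ p) (w ∘ (extChartAt I p).symm) γ' (x, y) := by
  have hF : ((extChartAt (I.prod 𝓘(ℝ, E')) (p, q)).symm : E × E' → M × E') =
      fun z => ((extChartAt I p).symm z.1, z.2) := by
    rw [extChartAt_prod, extChartAt_model_space_eq_id]
    rfl
  have h1 : HasMFDerivAt 𝓘(ℝ, E × E') I (fun z : E × E' => (extChartAt I p).symm z.1) (x, y)
      ((mfderiv 𝓘(ℝ, E) I (extChartAt I p).symm x).comp (ContinuousLinearMap.fst ℝ E E')) :=
    HasMFDerivAt.comp (x, y) (mdifferentiableAt_extChartAt_symm hx).hasMFDerivAt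
      (hasFDerivAt_fst (𝕜 := ℝ) (p := (x, y))).hasMFDerivAt
  have h2 := (hasFDerivAt_snd (𝕜 := ℝ) (p := (x, y))).hasMFDerivAt
  have h := h1.prodMk h2
  rw [← hF] at h
  refine ContinuousLinearMap.ext fun u => ContinuousLinearMap.ext fun v => ?_
  have := pullback_warpedProduct_apply γ w γ' h u v
  rw [hF] at this
  unfold inChart
  rw [hF]
  exact this

theorem inChart_model_space (G : BilinField 𝓘(ℝ, E) E) (q : E) : inChart 𝓘(ℝ, E) G q = G := by
  funext x
  unfold inChart pullback
  rw [extChartAt_model_space_eq_id]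
  change pullForm (E := E) (E' := E) (mfderiv 𝓘(ℝ, E) 𝓘(ℝ, E) id x) (G x) = G x
  rw [mfderiv_id]
  rfl

/-- A partial diffeomorphism times the identity. -/
def prodIdPartialDiffeomorph (Ψ : PartialDiffeomorph I K M P ∞) :
    PartialDiffeomorph (I.prod J) (K.prod J) (M × N) (P × N) ∞ where
  toPartialEquiv := Ψ.toPartialEquiv.prod (PartialEquiv.refl N)
  open_source := Ψ.open_source.prod isOpen_univ
  open_target := Ψ.open_target.prod isOpen_univ
  contMDiffOn_toFun := Ψ.contMDiffOn_toFun.prodMap contMDiffOn_id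
  contMDiffOn_invFun := Ψ.contMDiffOn_invFun.prodMap contMDiffOn_id

/-- A local isometry of the bases which matches the warping functions gives a local isometry of the
warped products. -/
theorem locallyIsometricAt_warpedProduct {γ : BilinField I M} {w : M → ℝ} {γP : BilinField K P}
    {wP : P → ℝ} {γ' : BilinField J N} {D : Set (P × N)} (Ψ : PartialDiffeomorph I K M P ∞) {p : M}
    (hp : p ∈ Ψ.source) (hD : ∀ y ∈ Ψ.target, ∀ q, (y, q) ∈ D)
    (hγ : ∀ x ∈ Ψ.source, ∀ u v : E,
      γP (Ψ x) (mfderiv I K Ψ x u) (mfderiv I K Ψ x v) = γ x u v)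
    (hw : ∀ x ∈ Ψ.source, wP (Ψ x) ^ 2 = w x ^ 2) (q : N) :
    LocallyIsometricAt (I.prod J) (K.prod J) (warpedProduct I J γ w γ') (warpedProduct K J γP wP γ')
      D (p, q) := by
  refine ⟨prodIdPartialDiffeomorph Ψ, ⟨hp, Set.mem_univ q⟩, fun y hy => hD y.1 hy.1 y.2,
    fun x hx => ?_⟩
  have hd := (Ψ.mdifferentiableAt (by simp) hx.1).hasMFDerivAt
  have hF := (hd.comp x (hasMFDerivAt_fst (I := I) (I' := J) x)).prodMk
    (hasMFDerivAt_snd (I := I) (I' := J) x)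
  refine ContinuousLinearMap.ext fun u => ContinuousLinearMap.ext fun v => ?_
  refine (pullback_warpedProduct_apply γP wP γ' hF u v).trans ?_
  refine Eq.trans ?_ (warpedProduct_apply γ w γ' x u v).symm
  have h1 := hγ x.1 hx.1 u.1 v.1
  have h2 := hw x.1 hx.1
  change γP (Ψ x.1) (mfderiv I K Ψ x.1 u.1) (mfderiv I K Ψ x.1 v.1)
    + wP (Ψ x.1) ^ 2 * γ' x.2 u.2 v.2 = _
  rw [h1, h2]

end Product

section Einstein

variable {E : Type*} [NormedAddCommGroup E] [NormedSpace ℝ E] [FiniteDimensional ℝ E]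
  {H : Type*} [TopologicalSpace H] {I : ModelWithCorners ℝ E H} [I.Boundaryless]
  {M : Type*} [TopologicalSpace M] [ChartedSpace H M] [IsManifold I ∞ M]
  {γ : Bundle.ContMDiffRiemannianMetric I ∞ E (fun p : M => TangentSpace I p)}
  {w : M → ℝ} (hw : ContMDiff I 𝓘(ℝ, ℝ) ∞ w) (hw0 : ∀ p, w p ≠ 0) {k : ModelSurface} {Λ : ℝ}
  (hE : IsEinstein (I.prod 𝓘(ℝ, ℝ × ℝ)) (warpedProduct I 𝓘(ℝ, ℝ × ℝ) γ.inner w k.metric) Λ)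
include hw hw0 hE

/-- In every chart of the base, the global Einstein equation becomes the local one. -/
theorem isEinsteinOn_inChart (p : M) :
    IsEinsteinOn (inChart I γ.inner p) (w ∘ (extChartAt I p).symm) k Λ (extChartAt I p).target where
  isMetricOn := isMetricOn_inChart_inner γ p
  pos x hx u hu := inChart_inner_pos γ hx hu
  contDiffAt x hx := contDiffAt_comp_extChartAt_symm hw hx
  ne_zero x _ := hw0 _
  ricci_eq x hx q u v := by
    have hmem : ((x, q) : E × (ℝ × ℝ)) ∈ (extChartAt (I.prod 𝓘(ℝ, ℝ × ℝ)) (p, q)).target := by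
      rw [extChartAt_prod, extChartAt_model_space_eq_id]
      exact ⟨hx, Set.mem_univ q⟩
    have h := hE (p, q) (x, q) hmem u v
    have hev : inChart (I.prod 𝓘(ℝ, ℝ × ℝ)) (warpedProduct I 𝓘(ℝ, ℝ × ℝ) γ.inner w k.metric) (p, q)
        =ᶠ[nhds (x, q)] warpedForm (inChart I γ.inner p) (w ∘ (extChartAt I p).symm) k.form := by
      filter_upwards [((isOpen_extChartAt_target p).prod isOpen_univ).mem_nhds
        (show ((x, q) : E × (ℝ × ℝ)) ∈ (extChartAt I p).target ×ˢ Set.univ from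
          ⟨hx, Set.mem_univ q⟩)] with z hz
      exact inChart_warpedProduct γ.inner w k.metric p q hz.1 z.2
    rwa [ricci_congr hev, hev.eq_of_nhds] at h

variable (b : Module.Basis (Fin 2) ℝ E)

omit hw hw0 hE [FiniteDimensional ℝ E] [I.Boundaryless] [IsManifold I ∞ M] in
/-- A property that holds near a point in a chart holds near it in the manifold. -/
theorem eventually_of_eventually_extChartAt {p : M} {Q : M → Prop}
    (h : ∀ᶠ x in nhds (extChartAt I p p), Q ((extChartAt I p).symm x)) : ∀ᶠ p' in nhds p, Q p' := by
  filter_upwards [(continuousAt_extChartAt p).eventually h, extChartAt_source_mem_nhds (I := I) p]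
    with p' h1 h2
  rwa [(extChartAt I p).left_inv h2] at h1

include b

/-- The quantity `w |dw|² - k w + Λ w³ / 3` is constant. -/
theorem isLocallyConstant_kottlerConst :
    IsLocallyConstant fun p : M => kottlerConst k Λ (w p) (normSqDeriv γ.inner w p) := by
  rw [IsLocallyConstant.iff_eventually_eq]
  intro p
  have hp := mem_extChartAt_target (I := I) p
  refine eventually_of_eventually_extChartAt (I := I) ?_
  filter_upwards [(isEinsteinOn_inChart hw hw0 hE p).eventually_kottlerConst_eq b hp,
    (isOpen_extChartAt_target (I := I) p).mem_nhds hp] with x h hx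
  rw [gradSq_inChart γ hw hx, gradSq_inChart γ hw hp] at h
  simpa using h

omit [FiniteDimensional ℝ E] hw0 hE b in
theorem isOpen_mfderiv_ne_zero : IsOpen {p : M | mfderiv I 𝓘(ℝ, ℝ) w p ≠ 0} := by
  rw [isOpen_iff_mem_nhds]
  intro p hp
  have hpt := mem_extChartAt_target (I := I) p
  have hs := contDiffAt_comp_extChartAt_symm hw hpt
  refine eventually_of_eventually_extChartAt (I := I) ?_
  have hc : ContinuousAt (fderiv ℝ (w ∘ (extChartAt I p).symm)) (extChartAt I p p) :=
    (hs.fderiv_right (m := 0) (by simp)).continuousAt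
  have hne : fderiv ℝ (w ∘ (extChartAt I p).symm) (extChartAt I p p) ≠ 0 := by
    rw [Ne, fderiv_comp_extChartAt_symm_eq_zero_iff hw hpt, extChartAt_to_inv]
    exact hp
  filter_upwards [hc.eventually_ne hne, (isOpen_extChartAt_target (I := I) p).mem_nhds hpt]
    with x h hx
  rwa [Ne, fderiv_comp_extChartAt_symm_eq_zero_iff hw hx] at h

/-- Unless `w` is constant, its critical points have no interior. -/
theorem dense_mfderiv_ne_zero [PreconnectedSpace M] (hconst : ¬ ∃ a, ∀ p, w p = a) :
    Dense {p : M | mfderiv I 𝓘(ℝ, ℝ) w p ≠ 0} := by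
  -- `Z` is the set of degenerate critical points; it is open and closed.
  set Z : Set M := {p | mfderiv I 𝓘(ℝ, ℝ) w p = 0 ∧ k.curvature = Λ * w p ^ 2} with hZ
  have hclosed : IsClosed Z := by
    have h1 : IsClosed {p : M | mfderiv I 𝓘(ℝ, ℝ) w p = 0} := by
      rw [← isOpen_compl_iff]
      exact isOpen_mfderiv_ne_zero hw
    exact h1.inter (isClosed_eq continuous_const (continuous_const.mul (hw.continuous.pow 2)))
  have hloc : ∀ p ∈ Z, ∀ᶠ p' in nhds p, w p' = w p := by
    intro p hp
    have hpt := mem_extChartAt_target (I := I) p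
    refine eventually_of_eventually_extChartAt (I := I) ?_
    have hd : fderiv ℝ (w ∘ (extChartAt I p).symm) (extChartAt I p p) = 0 := by
      rw [fderiv_comp_extChartAt_symm_eq_zero_iff hw hpt, extChartAt_to_inv]
      exact hp.1
    have := (isEinsteinOn_inChart hw hw0 hE p).eventually_eq_of_degenerate b hpt hd
      (by simpa using hp.2)
    simpa using this
  have hopen : IsOpen Z := by
    rw [isOpen_iff_mem_nhds]
    intro p hp
    filter_upwards [(hloc p hp).eventually_nhds] with p' h
    refine ⟨?_, by rw [h.self_of_nhds]; exact hp.2⟩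
    have : w =ᶠ[nhds p'] fun _ => w p := h
    rw [this.mfderiv_eq]
    exact mfderiv_const
  rw [dense_iff_inter_open]
  rintro U hU ⟨p, hp⟩
  by_contra hne
  have hcrit : ∀ p' ∈ U, mfderiv I 𝓘(ℝ, ℝ) w p' = 0 := fun p' hp' => by
    by_contra h
    exact hne ⟨p', hp', h⟩
  have hpt := mem_extChartAt_target (I := I) p
  have hpZ : p ∈ Z := by
    refine ⟨hcrit p hp, ?_⟩
    have hev : ∀ᶠ x in nhds (extChartAt I p p), fderiv ℝ (w ∘ (extChartAt I p).symm) x = 0 := by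
      filter_upwards [(continuousAt_extChartAt_symm (I := I) p).preimage_mem_nhds
        (by rw [extChartAt_to_inv]; exact hU.mem_nhds hp),
        (isOpen_extChartAt_target (I := I) p).mem_nhds hpt] with x hxU hx
      exact (fderiv_comp_extChartAt_symm_eq_zero_iff hw hx).2 (hcrit _ hxU)
    simpa using
      (isEinsteinOn_inChart hw hw0 hE p).degenerate_of_eventually_fderiv_eq_zero b hpt hev
  have huniv : Z = Set.univ :=
    (isClopen_iff.1 ⟨hclosed, hopen⟩).resolve_left (Set.Nonempty.ne_empty ⟨p, hpZ⟩)
  have hlc : IsLocallyConstant w := by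
    rw [IsLocallyConstant.iff_eventually_eq]
    exact fun p' => hloc p' (huniv ▸ Set.mem_univ p')
  exact hconst ⟨w p, fun p' => hlc.apply_eq_of_preconnectedSpace p' p⟩

end Einstein

/-! ### The local isometry -/

section LocalIsometry

/-- The inverse function theorem, as a partial diffeomorphism. -/
theorem exists_partialDiffeomorph {E F : Type*} [NormedAddCommGroup E] [NormedSpace ℝ E]
    [CompleteSpace E] [NormedAddCommGroup F] [NormedSpace ℝ F] {ψ : E → F} {V : Set E} {x₀ : E}
    (hV : IsOpen V) (hx₀ : x₀ ∈ V) (hψ : ∀ x ∈ V, ContDiffAt ℝ ∞ ψ x)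
    (hinv : ∀ x ∈ V, (fderiv ℝ ψ x).IsInvertible) :
    ∃ R : PartialDiffeomorph 𝓘(ℝ, E) 𝓘(ℝ, F) E F ∞,
      x₀ ∈ R.source ∧ R.source ⊆ V ∧ ∀ x, R x = ψ x := by
  have hder : ∀ x ∈ V, ∃ e : E ≃L[ℝ] F, HasFDerivAt ψ (e : E →L[ℝ] F) x := fun x hx => by
    obtain ⟨e, he⟩ := hinv x hx
    exact ⟨e, he ▸ ((hψ x hx).differentiableAt (by simp)).hasFDerivAt⟩
  obtain ⟨e₀, he₀⟩ := hder x₀ hx₀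
  let R₀ := (hψ x₀ hx₀).toOpenPartialHomeomorph ψ he₀ (by simp)
  let R := R₀.restrOpen V hV
  have hR : ∀ x, R x = ψ x := fun x => rfl
  have hsource : R.source ⊆ V := fun x hx => hx.2
  refine ⟨{ toPartialEquiv := R.toPartialEquiv
            open_source := R.open_source
            open_target := R.open_target
            contMDiffOn_toFun := ?_
            contMDiffOn_invFun := ?_ }, ?_, hsource, hR⟩
  · exact contMDiffOn_iff_contDiffOn.2 fun x hx => (hψ x (hsource hx)).contDiffWithinAt
  · refine contMDiffOn_iff_contDiffOn.2 fun y hy => ?_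
    have hyV := hsource (R.map_target hy)
    obtain ⟨e, he⟩ := hder _ hyV
    exact (R.contDiffAt_symm hy he (hψ _ hyV)).contDiffWithinAt
  · exact ⟨(hψ x₀ hx₀).mem_toOpenPartialHomeomorph_source he₀ (by simp), hx₀⟩

theorem IsEinsteinOn.gradSq_pos {E : Type*} [NormedAddCommGroup E] [NormedSpace ℝ E]
    [FiniteDimensional ℝ E] {g : E → E →L[ℝ] E →L[ℝ] ℝ} {W : E → ℝ} {k : ModelSurface} {Λ : ℝ}
    {U : Set E} (h : IsEinsteinOn g W k Λ U) {x : E} (hx : x ∈ U) (hd : fderiv ℝ W x ≠ 0) :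
    0 < gradSq g W x := by
  have h1 := h.isMetricOn.apply_metricGrad (W := W) hx
  have hX : metricGrad g W x ≠ 0 := fun h0 => hd <| by
    ext v
    rw [← h1, h0]
    simp
  have := h.pos x hx _ hX
  rwa [h1] at this

/-- Around a point with `dW ≠ 0`, the map `(τ, W)`, with `τ` a conjugate of `W`, is an
isometry onto an open piece of the Riemannian base of the Kottler metric. -/
theorem IsEinsteinOn.exists_isometry {E : Type*} [NormedAddCommGroup E] [NormedSpace ℝ E]
    [FiniteDimensional ℝ E] (b : Module.Basis (Fin 2) ℝ E) {g : E → E →L[ℝ] E →L[ℝ] ℝ} {W : E → ℝ}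
    {k : ModelSurface} {Λ : ℝ} {U : Set E} (h : IsEinsteinOn g W k Λ U) {c : ℝ}
    (hc : ∀ x ∈ U, kottlerConst k Λ (W x) (gradSq g W x) = c)
    {x₀ : E} (hx₀ : x₀ ∈ U) (hd : fderiv ℝ W x₀ ≠ 0) :
    ∃ R : PartialDiffeomorph 𝓘(ℝ, E) 𝓘(ℝ, ℝ × ℝ) E (ℝ × ℝ) ∞,
      x₀ ∈ R.source ∧ R.source ⊆ U ∧ ∀ x ∈ R.source, (R x).2 = W x ∧
        0 < kottlerFun k.curvature c Λ (W x) ∧ ∀ u v,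
          diagForm (kottlerFun k.curvature c Λ (W x)) (1 / kottlerFun k.curvature c Λ (W x))
            (fderiv ℝ R x u) (fderiv ℝ R x v) = g x u v := by
  obtain ⟨V, hVU, hV, hx₀V, τ, hτ, hiso⟩ := h.isMetricOn.exists_conjugate b hx₀ h.pos h.contDiffAt
    (h.gradSq_pos hx₀ hd).ne' fun x hx => ⟨_, h.hessian_eq b hx⟩
  let ψ : E → ℝ × ℝ := fun x => (τ x, W x)
  have hψ : ∀ x ∈ V, ContDiffAt ℝ ∞ ψ x := fun x hx => (hτ x hx).prodMk (h.contDiffAt x (hVU hx))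
  have hfd : ∀ x ∈ V, ∀ u, fderiv ℝ ψ x u = (fderiv ℝ τ x u, fderiv ℝ W x u) := fun x hx u => by
    have := (((hτ x hx).differentiableAt (by simp)).hasFDerivAt.prodMk
      ((h.contDiffAt x (hVU hx)).differentiableAt (by simp)).hasFDerivAt).fderiv
    exact DFunLike.congr_fun this u
  have hinv : ∀ x ∈ V, (fderiv ℝ ψ x).IsInvertible := by
    intro x hx
    have hinj : Function.Injective (fderiv ℝ ψ x) := by
      refine (injective_iff_map_eq_zero (fderiv ℝ ψ x)).2 fun u hu => ?_
      rw [hfd x hx, Prod.mk_eq_zero] at hu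
      refine h.isMetricOn.nondeg x (hVU hx) u fun v => ?_
      rw [(hiso x hx).2, hu.1, hu.2]
      simp
    have hdim : Module.finrank ℝ E = Module.finrank ℝ (ℝ × ℝ) := by
      simp [Module.finrank_eq_card_basis b]
    exact ⟨(LinearEquiv.ofInjectiveOfFinrankEq (fderiv ℝ ψ x).toLinearMap hinj
      hdim).toContinuousLinearEquiv, rfl⟩
  obtain ⟨R, hR₀, hRV, hR⟩ := exists_partialDiffeomorph hV hx₀V hψ hinv
  refine ⟨R, hR₀, hRV.trans hVU, fun x hx => ?_⟩
  have hxV := hRV hx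
  have hxU := hVU hxV
  have hN := h.gradSq_eq hxU (hc x hxU)
  have hd' : fderiv ℝ W x ≠ 0 := fun h0 => (hiso x hxV).1 (by simp [gradSq, h0])
  rw [← hN]
  refine ⟨by rw [hR], h.gradSq_pos hxU hd', fun u v => ?_⟩
  rw [show (R : E → ℝ × ℝ) = ψ from funext hR, diagForm_apply, hfd x hxV, hfd x hxV,
    (hiso x hxV).2]

variable {E : Type*} [NormedAddCommGroup E] [NormedSpace ℝ E] [FiniteDimensional ℝ E]
  {H : Type*} [TopologicalSpace H] {I : ModelWithCorners ℝ E H} [I.Boundaryless]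
  {M : Type*} [TopologicalSpace M] [ChartedSpace H M] [IsManifold I ∞ M]
  {γ : Bundle.ContMDiffRiemannianMetric I ∞ E (fun p : M => TangentSpace I p)}
  {w : M → ℝ} {k : ModelSurface} {Λ : ℝ}

/-- A chart as a partial diffeomorphism to the model space. -/
def extChartPartialDiffeomorph (I : ModelWithCorners ℝ E H) [I.Boundaryless]
    {M : Type*} [TopologicalSpace M] [ChartedSpace H M] [IsManifold I ∞ M] (p : M) :
    PartialDiffeomorph I 𝓘(ℝ, E) M E ∞ where
  toPartialEquiv := extChartAt I p
  open_source := isOpen_extChartAt_source p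
  open_target := isOpen_extChartAt_target p
  contMDiffOn_toFun := by
    rw [extChartAt_source]
    exact contMDiffOn_extChartAt
  contMDiffOn_invFun := contMDiffOn_extChartAt_symm p

omit [FiniteDimensional ℝ E] in
theorem inChart_extChartAt (G : BilinField I M) {p x : M} (hx : x ∈ (extChartAt I p).source)
    (u v : E) :
    inChart I G p (extChartAt I p x) (mfderiv I 𝓘(ℝ, E) (extChartAt I p) x u)
      (mfderiv I 𝓘(ℝ, E) (extChartAt I p) x v) = G x u v := by
  have : IsManifold I 1 M := IsManifold.of_le (n := ∞) (by simp)
  have hcomp := mfderivWithin_extChartAt_symm_comp_mfderiv_extChartAt' (I := I) hx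
  rw [I.range_eq_univ, mfderivWithin_univ] at hcomp
  have hu : ∀ a, a = x → ∀ u' v' : E, u' = u → v' = v → G a u' v' = G x u v := by
    rintro a rfl _ _ rfl rfl
    rfl
  exact hu _ ((extChartAt I p).left_inv hx) _ _ (DFunLike.congr_fun hcomp u)
    (DFunLike.congr_fun hcomp v)

/-- The local isometry is a chart followed by `(τ, w)`, times the identity of `ℝ²`. -/
theorem locallyIsometricAt_kottler (b : Module.Basis (Fin 2) ℝ E)
    (hw : ContMDiff I 𝓘(ℝ, ℝ) ∞ w) (hw0 : ∀ p, 0 < w p)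
    (hE : IsEinstein (I.prod 𝓘(ℝ, ℝ × ℝ)) (warpedProduct I 𝓘(ℝ, ℝ × ℝ) γ.inner w k.metric) Λ)
    {c : ℝ} (hc : ∀ p, kottlerConst k Λ (w p) (normSqDeriv γ.inner w p) = c) {p : M}
    (hp : mfderiv I 𝓘(ℝ, ℝ) w p ≠ 0) (q : ℝ × ℝ) :
    LocallyIsometricAt (I.prod 𝓘(ℝ, ℝ × ℝ)) (𝓘(ℝ, ℝ × ℝ).prod 𝓘(ℝ, ℝ × ℝ))
      (warpedProduct I 𝓘(ℝ, ℝ × ℝ) γ.inner w k.metric) (kottler k c Λ) (kottlerDomain k c Λ)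
      (p, q) := by
  have hpt := mem_extChartAt_target (I := I) p
  obtain ⟨R, hR₀, hRU, hR⟩ := (isEinsteinOn_inChart hw (fun p => (hw0 p).ne') hE p).exists_isometry
    b (fun x hx => by rw [gradSq_inChart γ hw hx]; exact hc _) hpt (by
      rw [Ne, fderiv_comp_extChartAt_symm_eq_zero_iff hw hpt, extChartAt_to_inv]
      exact hp)
  let Ψ := (extChartPartialDiffeomorph I p).trans R
  have hsrc : ∀ x ∈ Ψ.source, x ∈ (extChartAt I p).source ∧ extChartAt I p x ∈ R.source :=
    fun x hx => hx
  have h2 : ∀ x ∈ Ψ.source, (Ψ x).2 = w x := fun x hx => by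
    refine (hR _ (hsrc x hx).2).1.trans ?_
    rw [Function.comp_apply, (extChartAt I p).left_inv (hsrc x hx).1]
  refine locallyIsometricAt_warpedProduct Ψ ⟨mem_extChartAt_source p, hR₀⟩ ?_ ?_ ?_ q
  · intro y hy q
    have hx := Ψ.toPartialEquiv.map_target hy
    have hy' : Ψ (Ψ.toPartialEquiv.symm y) = y := Ψ.toPartialEquiv.right_inv hy
    have e := h2 _ hx
    rw [hy'] at e
    have hpos := (hR _ (hsrc _ hx).2).2.1
    rw [Function.comp_apply, (extChartAt I p).left_inv (hsrc _ hx).1, ← e] at hpos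
    exact ⟨by rw [e]; exact hw0 _, hpos⟩
  · intro x hx u v
    have hxs := (hsrc x hx).1
    have hΨ : mfderiv I 𝓘(ℝ, ℝ × ℝ) Ψ x = (mfderiv 𝓘(ℝ, E) 𝓘(ℝ, ℝ × ℝ) R (extChartAt I p x)).comp
        (mfderiv I 𝓘(ℝ, E) (extChartAt I p) x) :=
      mfderiv_comp x (R.mdifferentiableAt (by simp) (hsrc x hx).2)
        ((extChartPartialDiffeomorph I p).mdifferentiableAt (by simp) hxs)
    have hg := (hR _ (hsrc x hx).2).2.2 (mfderiv I 𝓘(ℝ, E) (extChartAt I p) x u)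
      (mfderiv I 𝓘(ℝ, E) (extChartAt I p) x v)
    rw [Function.comp_apply, (extChartAt I p).left_inv hxs] at hg
    rw [hΨ, mfderiv_eq_fderiv, h2 x hx]
    exact hg.trans (inChart_extChartAt γ.inner hxs u v)
  · intro x hx
    rw [h2 x hx]

end LocalIsometry

/-! ### Conclusion -/

section Conclusion

theorem warpedProduct_neg {E : Type*} [NormedAddCommGroup E] [NormedSpace ℝ E]
    {H : Type*} [TopologicalSpace H] {I : ModelWithCorners ℝ E H}
    {M : Type*} [TopologicalSpace M] [ChartedSpace H M]
    {E' : Type*} [NormedAddCommGroup E'] [NormedSpace ℝ E']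
    {H' : Type*} [TopologicalSpace H'] {J : ModelWithCorners ℝ E' H'}
    {N : Type*} [TopologicalSpace N] [ChartedSpace H' N]
    (γ : BilinField I M) (w : M → ℝ) (γ' : BilinField J N) :
    warpedProduct I J γ (-w) γ' = warpedProduct I J γ w γ' := by
  funext m
  simp [warpedProduct]

theorem pos_or_neg_of_ne_zero {M : Type*} [TopologicalSpace M] [PreconnectedSpace M] {w : M → ℝ}
    (hw : Continuous w) (hw0 : ∀ p, w p ≠ 0) : (∀ p, 0 < w p) ∨ ∀ p, 0 < (-w) p := by
  have hclopen : IsClopen {p | 0 < w p} := by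
    refine ⟨?_, isOpen_lt continuous_const hw⟩
    have : {p | 0 < w p} = {p | 0 ≤ w p} := Set.ext fun p => (hw0 p).symm.le_iff_lt.symm
    rw [this]
    exact isClosed_le continuous_const hw
  rcases isClopen_iff.1 hclopen with h | h
  · exact Or.inr fun p => neg_pos.2 <|
      lt_of_le_of_ne (not_lt.1 fun hp => (h ▸ hp : p ∈ (∅ : Set M))) (hw0 p)
  · exact Or.inl fun p => (h ▸ Set.mem_univ p : p ∈ {p | 0 < w p})

variable {E : Type*} [NormedAddCommGroup E] [NormedSpace ℝ E] [FiniteDimensional ℝ E]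
  {H : Type*} [TopologicalSpace H] {I : ModelWithCorners ℝ E H} [I.Boundaryless]
  {M : Type*} [TopologicalSpace M] [ChartedSpace H M] [IsManifold I ∞ M]
  {γ : Bundle.ContMDiffRiemannianMetric I ∞ E (fun p : M => TangentSpace I p)}
  {w : M → ℝ} {k : ModelSurface} {Λ : ℝ}

theorem exists_locallyIsometricAt_kottler_of_pos [ConnectedSpace M] (b : Module.Basis (Fin 2) ℝ E)
    (hw : ContMDiff I 𝓘(ℝ, ℝ) ∞ w) (hw0 : ∀ p, 0 < w p)
    (hE : IsEinstein (I.prod 𝓘(ℝ, ℝ × ℝ)) (warpedProduct I 𝓘(ℝ, ℝ × ℝ) γ.inner w k.metric) Λ) :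
    ∃ c : ℝ, ∀ p : M, mfderiv I 𝓘(ℝ, ℝ) w p ≠ 0 → ∀ q : ℝ × ℝ,
      LocallyIsometricAt (I.prod 𝓘(ℝ, ℝ × ℝ)) (𝓘(ℝ, ℝ × ℝ).prod 𝓘(ℝ, ℝ × ℝ))
        (warpedProduct I 𝓘(ℝ, ℝ × ℝ) γ.inner w k.metric) (kottler k c Λ) (kottlerDomain k c Λ)
        (p, q) := by
  obtain ⟨p₀⟩ := (inferInstance : Nonempty M)
  have hconst := isLocallyConstant_kottlerConst hw (fun p => (hw0 p).ne') hE b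
  exact ⟨_, fun p hp q => locallyIsometricAt_kottler b hw hw0 hE
    (fun p => hconst.apply_eq_of_preconnectedSpace p p₀) hp q⟩

/-- The sign of `w` is irrelevant, since only `w²` enters; `r = |w|`. -/
theorem exists_locallyIsometricAt_kottler [ConnectedSpace M] (b : Module.Basis (Fin 2) ℝ E)
    (hw : ContMDiff I 𝓘(ℝ, ℝ) ∞ w) (hw0 : ∀ p, w p ≠ 0)
    (hE : IsEinstein (I.prod 𝓘(ℝ, ℝ × ℝ)) (warpedProduct I 𝓘(ℝ, ℝ × ℝ) γ.inner w k.metric) Λ) :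
    ∃ c : ℝ, ∀ p : M, mfderiv I 𝓘(ℝ, ℝ) w p ≠ 0 → ∀ q : ℝ × ℝ,
      LocallyIsometricAt (I.prod 𝓘(ℝ, ℝ × ℝ)) (𝓘(ℝ, ℝ × ℝ).prod 𝓘(ℝ, ℝ × ℝ))
        (warpedProduct I 𝓘(ℝ, ℝ × ℝ) γ.inner w k.metric) (kottler k c Λ) (kottlerDomain k c Λ)
        (p, q) := by
  rcases pos_or_neg_of_ne_zero hw.continuous hw0 with h | h
  · exact exists_locallyIsometricAt_kottler_of_pos b hw h hE
  · rw [← warpedProduct_neg] at hE ⊢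
    obtain ⟨c, hc⟩ := exists_locallyIsometricAt_kottler_of_pos b hw.neg h hE
    refine ⟨c, fun p hp => hc p fun h0 => hp ?_⟩
    have h1 : mfderiv I 𝓘(ℝ, ℝ) (-w) p = 0 := h0
    rw [mfderiv_neg] at h1
    exact neg_eq_zero.1 h1

theorem isEinstein_of_forall_eq (hw : ContMDiff I 𝓘(ℝ, ℝ) ∞ w) (hw0 : ∀ p, w p ≠ 0)
    (hE : IsEinstein (I.prod 𝓘(ℝ, ℝ × ℝ)) (warpedProduct I 𝓘(ℝ, ℝ × ℝ) γ.inner w k.metric) Λ)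
    {a : ℝ} (ha : ∀ p, w p = a) : IsEinstein I γ.inner Λ := by
  intro p x hx u v
  refine (isEinsteinOn_inChart hw hw0 hE p).ricci_of_eventually_fderiv_eq_zero hx ?_ u v
  refine Filter.Eventually.of_forall fun y => ?_
  rw [show w ∘ (extChartAt I p).symm = fun _ => a from funext fun y => ha _, fderiv_const_apply]

theorem curvature_eq_of_forall_eq [Nonempty M] (b : Module.Basis (Fin 2) ℝ E)
    (hw : ContMDiff I 𝓘(ℝ, ℝ) ∞ w) (hw0 : ∀ p, w p ≠ 0)
    (hE : IsEinstein (I.prod 𝓘(ℝ, ℝ × ℝ)) (warpedProduct I 𝓘(ℝ, ℝ × ℝ) γ.inner w k.metric) Λ)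
    {a : ℝ} (ha : ∀ p, w p = a) : k.curvature = Λ * a ^ 2 := by
  obtain ⟨p⟩ := (inferInstance : Nonempty M)
  have hconst : w ∘ (extChartAt I p).symm = fun _ => a := funext fun y => ha _
  have := (isEinsteinOn_inChart hw hw0 hE p).degenerate_of_eventually_fderiv_eq_zero b
    (mem_extChartAt_target p) (Filter.Eventually.of_forall fun y => by
      rw [hconst, fderiv_const_apply])
  rwa [hconst] at this

theorem ModelSurface.isEinstein_smul_metric (k : ModelSurface) {a Λ : ℝ} (ha : a ≠ 0)
    (h : k.curvature = Λ * a) : IsEinstein 𝓘(ℝ, ℝ × ℝ) (fun q => a • k.metric q) Λ := by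
  intro p x _ u v
  rw [inChart_model_space]
  refine (ricci_smul k.isMetricOn_form (Set.mem_univ x) ha u v).trans ?_
  rw [k.ricci_form, h, mul_assoc]
  rfl

end Conclusion

end WarpedEinstein

end

open WarpedEinstein in
theorem proposition2p2
    {S : Type*} [TopologicalSpace S] [ChartedSpace (EuclideanSpace ℝ (Fin 2)) S]
    [IsManifold (𝓡 2) ∞ S] [ConnectedSpace S]
    (γ₁ : Bundle.ContMDiffRiemannianMetric (𝓡 2) ∞ (EuclideanSpace ℝ (Fin 2))
      (fun p : S => TangentSpace (𝓡 2) p))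
    (w : S → ℝ) (hw : ContMDiff (𝓡 2) 𝓘(ℝ, ℝ) ∞ w) (hw0 : ∀ p, w p ≠ 0)
    (k : ModelSurface) (Λ : ℝ)
    (hE : IsEinstein ((𝓡 2).prod 𝓘(ℝ, ℝ × ℝ))
      (warpedProduct (𝓡 2) 𝓘(ℝ, ℝ × ℝ) γ₁.inner w k.metric) Λ) :
    ((¬ ∃ a : ℝ, ∀ p, w p = a) →
      Dense {p : S | mfderiv (𝓡 2) 𝓘(ℝ, ℝ) w p ≠ 0} ∧
      ∃ c : ℝ, ∀ p : S, mfderiv (𝓡 2) 𝓘(ℝ, ℝ) w p ≠ 0 → ∀ q : ℝ × ℝ,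
        LocallyIsometricAt ((𝓡 2).prod 𝓘(ℝ, ℝ × ℝ)) (𝓘(ℝ, ℝ × ℝ).prod 𝓘(ℝ, ℝ × ℝ))
          (warpedProduct (𝓡 2) 𝓘(ℝ, ℝ × ℝ) γ₁.inner w k.metric)
          (kottler k c Λ) (kottlerDomain k c Λ) (p, q)) ∧
    (∀ a : ℝ, (∀ p, w p = a) →
      IsEinstein (𝓡 2) γ₁.inner Λ ∧
      IsEinstein 𝓘(ℝ, ℝ × ℝ) (fun q => a ^ 2 • k.metric q) Λ ∧
      Λ = k.curvature / a ^ 2) := by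
  have b := (EuclideanSpace.basisFun (Fin 2) ℝ).toBasis
  refine ⟨fun h => ⟨dense_mfderiv_ne_zero hw hw0 hE b h,
    exists_locallyIsometricAt_kottler b hw hw0 hE⟩, fun a ha => ?_⟩
  obtain ⟨p⟩ := (inferInstance : Nonempty S)
  have ha0 : a ^ 2 ≠ 0 := pow_ne_zero 2 (ha p ▸ hw0 p)
  have hk := curvature_eq_of_forall_eq b hw hw0 hE ha
  exact ⟨isEinstein_of_forall_eq hw hw0 hE ha, k.isEinstein_smul_metric ha0 hk, by
    rw [hk, mul_div_cancel_right₀ _ ha0]⟩
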